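/- Let $k$ be a field, and let $Q$ be a finite ordered quiver, i.e. a quiver with finitely many vertices and arrows and without non-trivial oriented cycles; let $Q_0$ be its set of vertices. Let $R$ be a set of relations on $Q$, each of them a $k$-linear combination of paths from one vertex $a$ to one vertex $b$, and let $(Q,R)\text{-Rep}$ be the abelian category of finite dimensional $k$-linear representations of $Q$ that satisfy the relations in $R$. Assume that $R$ consists of tensor relations: only non-trivial paths occur in $R$, and $(Q,R)\text{-Rep}$ contains the unit object of $Q\text{-Rep}$ for the vertex-wise tensor product ($k$ at every vertex, the identity at every arrow) and is closed under the vertex-wise tensor product. Let $D(Q)=D^b((Q,R)\text{-Rep})$ be the bounded derived category with the vertex-wise tensor product and the unit object $U$. A tensor ideal of $T=D(Q)$ is a full, thick, triangulated subcategory $J$ with $V\otimes V'\in J$ for all $V\in J$ and $V'\in T$; it is prime if it is proper and $V\otimes V'\in J$ implies $V\in J$ or $V'\in J$. Let $\mathrm{Spc}(T)$ be the set of prime tensor ideals, with the topology whose closed sets are the sets $\{P : S\cap P=\emptyset\}$ for sets $S$ of objects. Put $\mathrm{supp}(a)=\{P : a\notin P\}$ and, for $Z\subseteq\mathrm{Spc}(T)$,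 let $T_Z$ be the full subcategory of the objects $a$ with $\mathrm{supp}(a)\subseteq Z$. Balmer's structure sheaf $\mathcal O_Q$ is the sheafification of the presheaf of $k$-algebras on $\mathrm{Spc}(T)$ given by $W\mapsto \mathrm{End}_{T/T_Z}(U)$ for $W$ open and $Z=\mathrm{Spc}(T)\setminus W$, where $T/T_Z$ is the Verdier quotient; $\mathrm{Spec}(T)=(\mathrm{Spc}(T),\mathcal O_Q)$. Theorem. The space $\mathrm{Spc}(D(Q))$ is discrete, and $n\mapsto P_n=\{V : H^i(V)_n=0 \text{ for all } i\}$ is a bijection from $Q_0$ to $\mathrm{Spc}(D(Q))$. The structure sheaf $\mathcal O_Q$ is isomorphic to the constant sheaf of $k$-algebras $k$. That is, with the identification $\mathrm{Spc}(D(Q))=Q_0$, for every $W\subseteq Q_0$ there is an isomorphism of $k$-algebras $\mathcal O_Q(W)\cong k^{\oplus W}$. -/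

import Mathlib

open CategoryTheory CategoryTheory.Limits CategoryTheory.MonoidalCategory
open CategoryTheory.Pretriangulated TopologicalSpace Opposite ZeroObject

universe u v w

noncomputable section

namespace QuiverSheaf

section Tensor

/-! ### The tensor product on a bounded derived category -/

variable {A : Type u} [Category.{v} A] [Abelian A]

/-- Bounded cochain complexes. -/
def IsBounded (K : CochainComplex A ℤ) : Prop :=
  ∃ a b : ℤ, K.IsStrictlyGE a ∧ K.IsStrictlyLE b

lemma hasCoproduct_of_finite_support {I : Type*} (X : I → A) (s : Set I) (hs : s.Finite)
    (h : ∀ i, i ∉ s → IsZero (X i)) : HasCoproduct X := by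
  classical
  have : Finite s := hs
  let c : Cofan (fun i : s => X i) := Cofan.mk _ (Sigma.ι (fun i : s => X i))
  let hc : IsColimit c := coproductIsCoproduct (fun i : s => X i)
  refine ⟨⟨⟨Cofan.mk c.pt (fun i => if hi : i ∈ s then c.inj ⟨i, hi⟩ else 0), ?_⟩⟩⟩
  refine Cofan.IsColimit.mk _ (fun t => Cofan.IsColimit.desc hc fun i => t.inj i.1) ?_ ?_
  · intro t i
    by_cases hi : i ∈ s
    · simp [hi]
    · exact (h i hi).eq_of_src _ _
  · intro t m hm
    refine Cofan.IsColimit.hom_ext hc _ _ fun i => ?_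
    have := hm i.1
    rw [Cofan.IsColimit.fac]
    rw [← this]
    simp [Cofan.inj, Cofan.mk, i.2]

section Complexes

variable [MonoidalCategory A] [MonoidalPreadditive A]

lemma isZero_tensor_left {X Y : A} (h : IsZero X) : IsZero (X ⊗ Y) := by
  rw [IsZero.iff_id_eq_zero] at h ⊢
  rw [← id_whiskerRight, h, MonoidalPreadditive.zero_whiskerRight]

lemma isZero_tensor_right {X Y : A} (h : IsZero Y) : IsZero (X ⊗ Y) := by
  rw [IsZero.iff_id_eq_zero] at h ⊢
  rw [← whiskerLeft_id, h, MonoidalPreadditive.whiskerLeft_zero]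

lemma hasMapBifunctor_of_isBounded {K L : CochainComplex A ℤ} (hK : IsBounded K)
    (hL : IsBounded L) :
    HomologicalComplex.HasMapBifunctor K L (curriedTensor A) (ComplexShape.up ℤ) := by
  obtain ⟨a, b, _, _⟩ := hK
  obtain ⟨a', b', _, _⟩ := hL
  intro n
  refine hasCoproduct_of_finite_support _
    (Subtype.val ⁻¹' (Set.Icc a b ×ˢ Set.Icc a' b'))
    (((Set.finite_Icc a b).prod (Set.finite_Icc a' b')).preimage
      Subtype.val_injective.injOn) ?_
  rintro ⟨⟨i, j⟩, hij⟩ h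
  simp only [Set.mem_preimage, Set.mem_prod, Set.mem_Icc, not_and_or, not_le] at h
  rcases h with (h | h) | (h | h)
  · exact isZero_tensor_left (K.isZero_of_isStrictlyGE a i h)
  · exact isZero_tensor_left (K.isZero_of_isStrictlyLE b i h)
  · exact isZero_tensor_right (L.isZero_of_isStrictlyGE a' j h)
  · exact isZero_tensor_right (L.isZero_of_isStrictlyLE b' j h)

/-- The tensor product of two bounded complexes: in degree `n` it is the direct sum
of the objects `K.X i ⊗ L.X j` for `i + j = n`, with the usual differential. -/
def tensorComplex (K L : CochainComplex A ℤ) (hK : IsBounded K) (hL : IsBounded L) :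
    CochainComplex A ℤ :=
  haveI := hasMapBifunctor_of_isBounded hK hL
  HomologicalComplex.mapBifunctor K L (curriedTensor A) (ComplexShape.up ℤ)

lemma isZero_tensorComplex_X {K L : CochainComplex A ℤ} (hK : IsBounded K) (hL : IsBounded L)
    (n : ℤ) (h : ∀ i j : ℤ, i + j = n → IsZero (K.X i ⊗ L.X j)) :
    IsZero ((tensorComplex K L hK hL).X n) := by
  have := hasMapBifunctor_of_isBounded hK hL
  rw [IsZero.iff_id_eq_zero]
  refine HomologicalComplex.mapBifunctor.hom_ext
    (K₁ := K) (K₂ := L) (F := curriedTensor A) (c := ComplexShape.up ℤ) fun i j hij => ?_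
  exact (h i j hij).eq_of_src _ _

lemma isBounded_tensorComplex {K L : CochainComplex A ℤ} (hK : IsBounded K) (hL : IsBounded L) :
    IsBounded (tensorComplex K L hK hL) := by
  obtain ⟨a, b, _, _⟩ := id hK
  obtain ⟨a', b', _, _⟩ := id hL
  refine ⟨a + a', b + b', ?_, ?_⟩
  · rw [CochainComplex.isStrictlyGE_iff]
    intro n hn
    refine isZero_tensorComplex_X hK hL n fun i j hij => ?_
    by_cases hi : i < a
    · exact isZero_tensor_left (K.isZero_of_isStrictlyGE a i hi)
    · exact isZero_tensor_right (L.isZero_of_isStrictlyGE a' j (by lia))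
  · rw [CochainComplex.isStrictlyLE_iff]
    intro n hn
    refine isZero_tensorComplex_X hK hL n fun i j hij => ?_
    by_cases hi : b < i
    · exact isZero_tensor_left (K.isZero_of_isStrictlyLE b i hi)
    · exact isZero_tensor_right (L.isZero_of_isStrictlyLE b' j (by lia))

end Complexes

variable [HasDerivedCategory.{w} A]

lemma exists_bounded_representative (X : DerivedCategory.Bounded A) :
    ∃ K : CochainComplex A ℤ, IsBounded K ∧ Nonempty (X.obj ≅ DerivedCategory.Q.obj K) := by
  obtain ⟨⟨a, _⟩, ⟨b, _⟩⟩ := X.property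
  obtain ⟨K, h₁, h₂, h⟩ := DerivedCategory.exists_iso_Q_obj_of_isGE_of_isLE X.obj a b
  exact ⟨K, ⟨a, b, h₁, h₂⟩, h⟩

lemma bounded_Q_obj {K : CochainComplex A ℤ} (hK : IsBounded K) :
    (DerivedCategory.TStructure.t (C := A)).bounded (DerivedCategory.Q.obj K) := by
  obtain ⟨a, b, h₁, h₂⟩ := hK
  exact ⟨⟨a, ⟨K, Iso.refl _, h₁⟩⟩, ⟨b, ⟨K, Iso.refl _, h₂⟩⟩⟩

/-- The object of `D^b(A)` given by a bounded complex. -/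
def ofComplex (K : CochainComplex A ℤ) (hK : IsBounded K) : DerivedCategory.Bounded A :=
  ⟨DerivedCategory.Q.obj K, bounded_Q_obj hK⟩

/-- A bounded complex which represents the object `X` of `D^b(A)`. -/
def representative (X : DerivedCategory.Bounded A) : CochainComplex A ℤ :=
  (exists_bounded_representative X).choose

lemma isBounded_representative (X : DerivedCategory.Bounded A) : IsBounded (representative X) :=
  (exists_bounded_representative X).choose_spec.1

variable [MonoidalCategory A] [MonoidalPreadditive A]

/-- The tensor product of two objects of `D^b(A)`, where the tensor product of `A` is exact in
each factor: it is the tensor product of bounded complexes which represent the objects, and it is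
independent of these complexes up to isomorphism. -/
def tensorObj (X Y : DerivedCategory.Bounded A) : DerivedCategory.Bounded A :=
  ofComplex (tensorComplex (representative X) (representative Y)
      (isBounded_representative X) (isBounded_representative Y))
    (isBounded_tensorComplex _ _)

variable (A) in
/-- The unit object of `D^b(A)`: the unit object of `A`, placed in degree zero. -/
def unitObj : DerivedCategory.Bounded A :=
  ofComplex ((CochainComplex.singleFunctor A 0).obj (𝟙_ A))
    ⟨0, 0, inferInstance, inferInstance⟩

end Tensor

section Balmer

/-! ### The spectrum of a tensor triangulated category

Throughout, `T` is a triangulated category, `tens V W` is the tensor product of the objects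
`V` and `W`, and `unit` is the unit object. The spectrum and its structure sheaf depend on the
tensor product through the isomorphism classes of the objects `tens V W` only. -/

variable {T : Type u} [Category.{u} T] [HasZeroObject T] [HasShift T ℤ] [Preadditive T]
  [∀ n : ℤ, (shiftFunctor T n).Additive] [Pretriangulated T]

/-- `J` is a tensor ideal: a (strictly) full, thick, triangulated subcategory with
`V ⊗ W ∈ J` for all `V ∈ J` and `W ∈ T`. -/
structure IsTensorIdeal (tens : T → T → T) (J : ObjectProperty T) : Prop where
  triangulated : J.IsTriangulated
  isoClosed : J.IsClosedUnderIsomorphisms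
  thick : J.IsStableUnderRetracts
  tensor_mem : ∀ V W, J V → J (tens V W)

/-- `P` is a prime tensor ideal: a proper tensor ideal such that `V ⊗ W ∈ P` implies
`V ∈ P` or `W ∈ P`. -/
structure IsPrimeIdeal (tens : T → T → T) (P : ObjectProperty T) : Prop
    extends IsTensorIdeal tens P where
  ne_top : P ≠ ⊤
  mem_or_mem : ∀ V W, P (tens V W) → P V ∨ P W

/-- The set `Spc T` of prime tensor ideals. -/
def Spc (tens : T → T → T) : Type u := { P : ObjectProperty T // IsPrimeIdeal tens P }

variable (tens : T → T → T)

/-- The set `Z(S)` of the primes which do not meet the set of objects `S`. -/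
def zeroLocus (S : Set T) : Set (Spc tens) := {P | ∀ a ∈ S, ¬ P.1 a}

lemma prime_zero (P : Spc tens) : P.1 0 := by
  have := P.2.triangulated
  have := P.2.isoClosed
  exact ObjectProperty.prop_zero P.1

lemma prime_biprod (P : Spc tens) (a b : T) :
    P.1 (a ⊞ b) ↔ P.1 a ∧ P.1 b := by
  have := P.2.triangulated
  have := P.2.isoClosed
  have := P.2.thick
  refine ⟨fun h => ⟨ObjectProperty.IsStableUnderRetracts.of_biprod_left P.1 h,
    ObjectProperty.IsStableUnderRetracts.of_biprod_right P.1 h⟩, fun h => ?_⟩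
  exact ObjectProperty.ext_of_isTriangulatedClosed₂ P.1 _
    (binaryBiproductTriangle_distinguished a b) h.1 h.2

/-- The Zariski topology on `Spc T`: the closed sets are the sets `Z(S)`. -/
instance : TopologicalSpace (Spc tens) :=
  .ofClosed (Set.range (zeroLocus tens))
    ⟨{0}, by
      ext P
      simpa [zeroLocus] using prime_zero tens P⟩
    (fun 𝒜 h𝒜 => by
      refine ⟨⋃₀ {S | zeroLocus tens S ∈ 𝒜}, ?_⟩
      ext P
      simp only [Set.mem_sInter]
      constructor
      · intro h Z hZ
        obtain ⟨S, rfl⟩ := h𝒜 hZ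
        exact fun a ha => h a ⟨S, hZ, ha⟩
      · rintro h a ⟨S, hS, ha⟩
        exact h _ hS a ha)
    (by
      rintro _ ⟨S, rfl⟩ _ ⟨S', rfl⟩
      refine ⟨{c : T | ∃ a ∈ S, ∃ b ∈ S', c = (a ⊞ b : T)}, ?_⟩
      ext P
      constructor
      · intro h
        by_contra hcon
        simp only [zeroLocus, Set.mem_union, Set.mem_ofPred_eq, not_or, not_forall,
          not_not] at hcon
        obtain ⟨⟨a, ha, ha'⟩, ⟨b, hb, hb'⟩⟩ := hcon
        exact h _ ⟨a, ha, b, hb, rfl⟩ ((prime_biprod tens P a b).2 ⟨ha', hb'⟩)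
      · rintro (h | h) _ ⟨a, ha, b, hb, rfl⟩ hab
        · exact h a ha ((prime_biprod tens P a b).1 hab).1
        · exact h b hb ((prime_biprod tens P a b).1 hab).2)

/-- The support of an object: the set of the primes which do not contain it. -/
def supp (a : T) : Set (Spc tens) := {P | ¬ P.1 a}

/-- The full subcategory `T_Z` of the objects whose support is contained in `Z`. -/
def supportedOn (Z : Set (Spc tens)) : ObjectProperty T := fun a => supp tens a ⊆ Z

lemma supportedOn_iff (Z : Set (Spc tens)) (a : T) :
    supportedOn tens Z a ↔ ∀ P : Spc tens, P ∉ Z → P.1 a :=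
  ⟨fun h _ hP => by_contra fun hc => hP (h hc), fun h P hP => by_contra fun hc => hP (h P hc)⟩

instance (Z : Set (Spc tens)) : (supportedOn tens Z).IsClosedUnderIsomorphisms where
  of_iso e h := by
    rw [supportedOn_iff] at h ⊢
    intro P hP
    have := P.2.isoClosed
    exact ObjectProperty.prop_of_iso P.1 e (h P hP)

instance (Z : Set (Spc tens)) : (supportedOn tens Z).IsTriangulated where
  exists_zero := ⟨0, isZero_zero _, (supportedOn_iff tens Z 0).2 fun P _ => prime_zero tens P⟩
  isStableUnderShiftBy n := ⟨fun a ha => by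
    change supportedOn tens Z _
    rw [supportedOn_iff] at ha ⊢
    intro P hP
    have := P.2.triangulated
    exact ObjectProperty.le_shift P.1 n _ (ha P hP)⟩
  toIsTriangulatedClosed₂ := .mk' fun t ht h₁ h₃ => by
    rw [supportedOn_iff] at h₁ h₃ ⊢
    intro P hP
    have := P.2.triangulated
    have := P.2.isoClosed
    exact ObjectProperty.ext_of_isTriangulatedClosed₂ P.1 t ht (h₁ P hP) (h₃ P hP)

/-- The Verdier quotient `T / T_Z`: the localization of `T` at the morphisms whose cone
lies in `T_Z`. -/
abbrev VerdierQuotient (Z : Set (Spc tens)) := (supportedOn tens Z).trW.Localization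

/-- The localization functor `T ⥤ T / T_Z`. -/
abbrev toQuotient (Z : Set (Spc tens)) : T ⥤ VerdierQuotient tens Z := (supportedOn tens Z).trW.Q

variable {tens} in
lemma inverts_of_subset {Z Z' : Set (Spc tens)} (h : Z ⊆ Z') :
    (supportedOn tens Z).trW.IsInvertedBy (toQuotient tens Z') := fun _ _ f hf =>
  (supportedOn tens Z').trW.Q_inverts f
    (ObjectProperty.trW_monotone (fun _ ha => Set.Subset.trans ha h) f hf)

variable {tens} in
/-- For `Z ⊆ Z'`, the functor `T / T_Z ⥤ T / T_{Z'}` induced by the localization functor. -/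
def quotientMap {Z Z' : Set (Spc tens)} (h : Z ⊆ Z') :
    VerdierQuotient tens Z ⥤ VerdierQuotient tens Z' :=
  Localization.Construction.lift (toQuotient tens Z') (inverts_of_subset h)

lemma toQuotient_comp_quotientMap {Z Z' : Set (Spc tens)} (h : Z ⊆ Z') :
    toQuotient tens Z ⋙ quotientMap h = toQuotient tens Z' :=
  Localization.Construction.fac _ _

instance {Z Z' : Set (Spc tens)} (h : Z ⊆ Z') :
    Localization.Lifting (toQuotient tens Z) (supportedOn tens Z).trW (toQuotient tens Z')
      (quotientMap h) := ⟨eqToIso (toQuotient_comp_quotientMap tens h)⟩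

lemma quotientMap_refl (Z : Set (Spc tens)) : quotientMap (subset_refl Z) = 𝟭 _ :=
  Localization.Construction.uniq _ _ (toQuotient_comp_quotientMap tens _)

lemma quotientMap_comp {Z Z' Z'' : Set (Spc tens)} (h : Z ⊆ Z') (h' : Z' ⊆ Z'') :
    quotientMap h ⋙ quotientMap h' = quotientMap (h.trans h') :=
  Localization.Construction.uniq _ _ (by
    rw [toQuotient_comp_quotientMap, ← Functor.assoc, toQuotient_comp_quotientMap,
      toQuotient_comp_quotientMap])

variable (unit : T)

lemma quotientMap_refl_map (Z : Set (Spc tens)) (f : End ((toQuotient tens Z).obj unit)) :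
    (quotientMap (subset_refl Z)).map f = f := by
  have h := Functor.congr_hom (quotientMap_refl tens Z) f
  exact h.trans ((Category.id_comp _).trans (Category.comp_id _))

lemma quotientMap_comp_map {Z Z' Z'' : Set (Spc tens)} (h : Z ⊆ Z') (h' : Z' ⊆ Z'')
    (f : End ((toQuotient tens Z).obj unit)) :
    (quotientMap (h.trans h')).map f = (quotientMap h').map ((quotientMap h).map f) := by
  have h := Functor.congr_hom (quotientMap_comp tens h h').symm f
  exact h.trans ((Category.id_comp _).trans (Category.comp_id _))

variable [IsTriangulated T]

instance {Z Z' : Set (Spc tens)} (h : Z ⊆ Z') : (quotientMap h).Additive := by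
  rw [Localization.functor_additive_iff (toQuotient tens Z) (supportedOn tens Z).trW
    (quotientMap h), toQuotient_comp_quotientMap]
  infer_instance

variable (k : Type v) [Field k] [Linear k T]

instance {Z Z' : Set (Spc tens)} (h : Z ⊆ Z') : (quotientMap h).Linear k :=
  (Localization.functor_linear_iff (toQuotient tens Z) (supportedOn tens Z).trW k
    (toQuotient tens Z') (quotientMap h)).1 inferInstance

/-- The homomorphism of `k`-algebras `End_{T/T_Z}(U) → End_{T/T_{Z'}}(U)` for `Z ⊆ Z'`. -/
def endMap {Z Z' : Set (Spc tens)} (h : Z ⊆ Z') :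
    End ((toQuotient tens Z).obj unit) →ₐ[k] End ((toQuotient tens Z').obj unit) where
  toFun f := (quotientMap h).map f
  map_one' := (quotientMap h).map_id _
  map_mul' f g := (quotientMap h).map_comp _ _
  map_zero' := (quotientMap h).map_zero _ _
  map_add' f g := (quotientMap h).map_add
  commutes' r := by
    rw [Algebra.algebraMap_eq_smul_one, Algebra.algebraMap_eq_smul_one]
    refine ((quotientMap h).map_smul r _).trans ?_
    exact congrArg (r • ·) ((quotientMap h).map_id _)

/-- The presheaf of `k`-algebras `W ↦ End_{T/T_Z}(U)` on `Spc T`, where `Z` is the complement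
of the open subset `W` and `U` is the unit object. -/
def endPresheaf : (Opens (TopCat.of (Spc tens)))ᵒᵖ ⥤ AlgCat.{u} k where
  obj W := AlgCat.of k (End ((toQuotient tens (W.unop : Set (Spc tens))ᶜ).obj unit))
  map {W W'} i := AlgCat.ofHom (endMap tens unit k (Set.compl_subset_compl.2 i.unop.le))
  map_id W := by
    ext f
    exact quotientMap_refl_map tens unit _ f
  map_comp i j := by
    ext f
    exact quotientMap_comp_map tens unit (Set.compl_subset_compl.2 i.unop.le)
      (Set.compl_subset_compl.2 j.unop.le) f

/-- Balmer's structure sheaf on `Spc T`, as a sheaf of `k`-algebras. -/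
def structureSheaf :
    Sheaf (Opens.grothendieckTopology (TopCat.of (Spc tens))) (AlgCat.{u} k) :=
  (presheafToSheaf _ _).obj (endPresheaf tens unit k)

end Balmer

section Rep

/-! ### Representations of quivers with relations -/

/-- The category of finite dimensional representations of the quiver `Q` over `k`, with the
vertex-wise tensor product. -/
abbrev QRep (k : Type u) [Field k] (Q : Type v) [Quiver.{w} Q] :=
  Paths Q ⥤ FGModuleCat.{u} k

/-- A set of relations on `Q`: for all vertices `a` and `b`, a set of `k`-linear combinations
of paths from `a` to `b`. -/
abbrev Relations (k : Type u) [Field k] (Q : Type v) [Quiver.{w} Q] :=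
  ∀ a b : Q, Set (Quiver.Path a b →₀ k)

variable {k : Type u} [Field k] {Q : Type v} [Quiver.{w} Q]

/-- The linear map `V_a → V_b` given by a `k`-linear combination `r` of paths from `a` to `b`. -/
def relAct (V : QRep k Q) {a b : Q} (r : Quiver.Path a b →₀ k) :
    V.obj ((Paths.of Q).obj a) ⟶ V.obj ((Paths.of Q).obj b) :=
  r.sum fun p c => c • V.map (X := (Paths.of Q).obj a) (Y := (Paths.of Q).obj b) p

variable (R : Relations k Q)

/-- `V` is a representation of the quiver with relations `(Q, R)`. -/
def satisfies : ObjectProperty (QRep k Q) :=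
  fun V => ∀ (a b : Q), ∀ r ∈ R a b, relAct V r = 0

lemma relAct_naturality {V V' : QRep k Q} (f : V ⟶ V') {a b : Q} (r : Quiver.Path a b →₀ k) :
    relAct V r ≫ f.app ((Paths.of Q).obj b) = f.app ((Paths.of Q).obj a) ≫ relAct V' r := by
  simp only [relAct, Finsupp.sum, Preadditive.sum_comp, Preadditive.comp_sum, Linear.smul_comp,
    Linear.comp_smul]
  refine Finset.sum_congr rfl fun p _ => ?_
  congr 1
  exact f.naturality (X := (Paths.of Q).obj a) (Y := (Paths.of Q).obj b) p

instance : (satisfies R).ContainsZero where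
  exists_zero := ⟨0, isZero_zero _, fun a _ _ _ =>
    (((isZero_zero (QRep k Q)).obj ((Paths.of Q).obj a))).eq_of_src _ _⟩

instance : (satisfies R).IsClosedUnderSubobjects where
  prop_of_mono {X Y} f _ hY a b r hr := by
    rw [← cancel_mono (f.app ((Paths.of Q).obj b)), relAct_naturality, hY a b r hr]
    simp

instance : (satisfies R).IsClosedUnderQuotients where
  prop_of_epi {X Y} f _ hX a b r hr := by
    rw [← cancel_epi (f.app ((Paths.of Q).obj a)), ← relAct_naturality, hX a b r hr]
    simp

instance : (satisfies R).IsClosedUnderFiniteProducts where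
  isClosedUnderLimitsOfShape J _ :=
    { limitsOfShape_le := by
        rintro X ⟨p⟩ a b r hr
        refine (isLimitOfPreserves ((evaluation _ _).obj ((Paths.of Q).obj b)) p.isLimit).hom_ext
          fun j => ?_
        have := relAct_naturality (p.π.app j) r
        rw [p.prop_diag_obj j a b r hr, comp_zero] at this
        simpa using! this }

/-- The abelian category `(Q, R)`-Rep of finite dimensional representations of `(Q, R)`
over `k`. -/
abbrev RelRep := (satisfies R).FullSubcategory

/-- Tensor relations: they involve only non-trivial paths, and `(Q, R)`-Rep is a monoidal
subcategory of the category of representations of `Q`, i.e. it contains the unit object and it is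
closed under the vertex-wise tensor product. -/
class IsTensorRelations : Prop where
  nontrivial : ∀ (a b : Q), ∀ r ∈ R a b, ∀ p ∈ r.support, p.length ≠ 0
  isMonoidal : (satisfies R).IsMonoidal

instance [IsTensorRelations R] : (satisfies R).IsMonoidal := IsTensorRelations.isMonoidal

instance : MonoidalPreadditive (QRep k Q) where

instance : HasDerivedCategory.{max (u + 1) v w} (RelRep R) := HasDerivedCategory.standard _

/-- The bounded derived category `D(Q)` of `(Q, R)`-Rep. -/
abbrev D := DerivedCategory.Bounded (RelRep R)

/-- The cohomology `H^i(V)_n` of an object `V` of `D(Q)` at the vertex `n`. -/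
abbrev cohomologyAt (V : D R) (i : ℤ) (n : Q) : FGModuleCat.{u} k :=
  ((DerivedCategory.homologyFunctor (RelRep R) i).obj V.obj).obj.obj ((Paths.of Q).obj n)

variable [IsTensorRelations R]

/-- The space `Spc D(Q)` of prime tensor ideals of `D(Q)`, for the vertex-wise tensor product. -/
abbrev SpcD : Type (max (u + 1) v w) := Spc (tensorObj (A := RelRep R))

/-- The structure sheaf `𝒪_Q` on `Spc D(Q)`. -/
abbrev structureSheafD :
    Sheaf (Opens.grothendieckTopology (TopCat.of (SpcD R))) (AlgCat.{max (u + 1) v w} k) :=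
  structureSheaf (tensorObj (A := RelRep R)) (unitObj (RelRep R)) k

/-- The constant sheaf of algebras `k` on `Spc D(Q)`. -/
abbrev constantSheafD :
    Sheaf (Opens.grothendieckTopology (TopCat.of (SpcD R))) (AlgCat.{max (u + 1) v w} k) :=
  (constantSheaf _ _).obj (AlgCat.of k (ULift.{max (u + 1) v w} k))

end Rep

end QuiverSheaf

end

/-! Everything rests on evaluation at a vertex `n`, which is exact and monoidal. Over a field, an
acyclic bounded complex of vector spaces is contractible, and a complex with nonzero cohomology in
degree `i` has `k` in degree `i` as a retract. Hence, as in the Künneth formula, the cohomology of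
`V ⊗ W` at `n` vanishes exactly if that of `V` or of `W` does. This makes `vanishesAt n` a prime
ideal (`isPrimeIdeal_vanishesAt`).

Conversely, let `P` be a prime. The simple objects `S_n` generate the derived category: a nonzero
representation has a simple subobject at a sink of its support, and induction on dimension applies
(`forall_mem_of_simpleObj_mem`). As `P` is proper, it misses some `S_n`. If `V` lies in `P` and has
cohomology at `n`, then `V ⊗ S_n` lies in `P`, and its cohomology is nonzero and concentrated at
`n`, so it has a shift of `S_n` as a retract (`retract_of_not_vanishesAt`), which is impossible. If
`V` vanishes at `n`, then `V ⊗ S_n` is zero and primality gives `V ∈ P`. So `P = vanishesAt n`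
(`eq_vanishesAt_of_simpleObj_notMem`). Since `S_n` lies in all these primes except the one at `n`,
points are closed, and the finite space is discrete.

The link between `V` and its part at `n` is the roof of exact functors `𝟭 ← resReach R n → resAt hQ
R n`. Both arrows are isomorphisms at `n`, so after division by `vanishesAt n` the functor `resAt`
may replace the identity. It turns the morphisms inverted in the quotient into isomorphisms and the
unit into `S_n`, whose endomorphisms are scalars. Therefore the unit has endomorphism algebra `k` in
each such quotient (`algebraMap_end_bijective`). On a discrete space, a presheaf of algebras with
value `k` at every point has the constant sheaf as its sheafification, and this is the sheaf of
`k`-valued functions. -/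

noncomputable section

namespace QuiverSheaf

/-! ### Evaluation at a vertex: exactness and joint detection -/

section Evaluation

variable {k : Type u} [Field k] {Q : Type v} [Quiver.{w} Q] (R : Relations k Q)

instance : (satisfies R).ι.PreservesHomology where
  preservesKernels _ _ f := (satisfies R).preservesKernels_ι f
  preservesCokernels _ _ f := (satisfies R).preservesCokernels_ι f

/-- The evaluation of representations at a vertex. -/
abbrev ev (n : Paths Q) : RelRep R ⥤ FGModuleCat.{u} k :=
  (satisfies R).ι ⋙ (evaluation (Paths Q) (FGModuleCat.{u} k)).obj n

instance (n : Paths Q) : ((evaluation (Paths Q) (FGModuleCat.{u} k)).obj n).PreservesHomology where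
  preservesKernels _ _ _ := inferInstance
  preservesCokernels _ _ _ := inferInstance

/-- Preservation of homology concerns only the diagrams `parallelPair f 0`; their images under `F`
are again of this form up to isomorphism, which lets `G` be applied. -/
lemma preservesHomology_comp {A B C : Type*} [Category* A] [Category* B] [Category* C]
    [HasZeroMorphisms A] [HasZeroMorphisms B] [HasZeroMorphisms C] (F : A ⥤ B) (G : B ⥤ C)
    [F.PreservesZeroMorphisms] [G.PreservesZeroMorphisms]
    [F.PreservesHomology] [G.PreservesHomology] :
    (F ⋙ G).PreservesHomology where
  preservesKernels X Y f := by
    have := Functor.PreservesHomology.preservesKernel F f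
    have := Functor.PreservesHomology.preservesKernel G (F.map f)
    have : PreservesLimit (parallelPair f 0 ⋙ F) G :=
      preservesLimit_of_iso_diagram G (diagramIsoParallelPair _ ≪≫
        parallelPair.ext (Iso.refl _) (Iso.refl _) (by simp) (by simp) :
          parallelPair f 0 ⋙ F ≅ parallelPair (F.map f) 0).symm
    infer_instance
  preservesCokernels X Y f := by
    have := Functor.PreservesHomology.preservesCokernel F f
    have := Functor.PreservesHomology.preservesCokernel G (F.map f)
    have : PreservesColimit (parallelPair f 0 ⋙ F) G :=
      preservesColimit_of_iso_diagram G (diagramIsoParallelPair _ ≪≫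
        parallelPair.ext (Iso.refl _) (Iso.refl _) (by simp) (by simp) :
          parallelPair f 0 ⋙ F ≅ parallelPair (F.map f) 0).symm
    infer_instance

instance (n : Paths Q) : (ev R n).PreservesHomology := preservesHomology_comp _ _

variable {R}

lemma isZero_of_ev {V : RelRep R} (h : ∀ n, IsZero ((ev R n).obj V)) : IsZero V := by
  rw [IsZero.iff_id_eq_zero]
  ext n : 3
  exact (h n).eq_of_src _ _

lemma exact_of_ev {S : ShortComplex (RelRep R)} (h : ∀ n, (S.map (ev R n)).Exact) : S.Exact := by
  rw [ShortComplex.exact_iff_isZero_homology]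
  refine isZero_of_ev fun n => ?_
  exact ((ShortComplex.exact_iff_isZero_homology _).1 (h n)).of_iso (S.mapHomologyIso (ev R n)).symm

lemma mono_of_ev {V W : RelRep R} (f : V ⟶ W) (h : ∀ n, Mono ((ev R n).map f)) : Mono f := by
  rw [Preadditive.mono_iff_cancel_zero]
  intro Z g hg
  ext n : 3
  have := h n
  have h0 := (ev R n).congr_map hg
  rw [Functor.map_comp, Functor.map_zero] at h0
  exact zero_of_comp_mono _ h0

end Evaluation

/-! ### Vector spaces cut off by a proposition -/

section Indicator

variable {k : Type u} [Field k]

/-- The space `V` if `p` holds, and zero otherwise. -/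
abbrev condObj (p : Prop) (V : FGModuleCat.{u} k) : FGModuleCat.{u} k :=
  FGModuleCat.of k (PLift p → V)

variable {p q r : Prop} {V W X : FGModuleCat.{u} k}

lemma isZero_of_subsingleton (V : FGModuleCat.{u} k) [Subsingleton V] : IsZero V := by
  rw [IsZero.iff_id_eq_zero]
  ext x
  exact Subsingleton.elim _ _

lemma isZero_iff_subsingleton (V : FGModuleCat.{u} k) : IsZero V ↔ Subsingleton V := by
  refine ⟨fun h => ⟨fun x y => ?_⟩, fun _ => isZero_of_subsingleton V⟩
  have h0 := h.eq_of_src (𝟙 V) 0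
  have hx (x : V) : x = 0 := congrArg (fun f => f.hom.hom x) h0
  rw [hx x, hx y]

lemma isZero_condObj (hp : ¬ p) (V : FGModuleCat.{u} k) : IsZero (condObj p V) := by
  have : IsEmpty (PLift p) := ⟨fun h => hp h.down⟩
  exact isZero_of_subsingleton _

/-- The isomorphism `condObj p V ≅ V` if `p` holds. -/
def condIso (hp : p) (V : FGModuleCat.{u} k) : condObj p V ≅ V where
  hom := FGModuleCat.ofHom (LinearMap.proj ⟨hp⟩)
  inv := FGModuleCat.ofHom (LinearMap.pi fun _ => LinearMap.id)
  hom_inv_id := FGModuleCat.hom_ext (LinearMap.ext fun _ => rfl)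
  inv_hom_id := FGModuleCat.hom_ext (LinearMap.ext fun _ => rfl)

open Classical in
/-- The morphism `condObj p V ⟶ condObj q W` given by `f` if `p` and `q` hold. -/
def condMap (p q : Prop) (f : V ⟶ W) : condObj p V ⟶ condObj q W :=
  if h : p ∧ q then (condIso h.1 V).hom ≫ f ≫ (condIso h.2 W).inv else 0

lemma condMap_eq (hp : p) (hq : q) (f : V ⟶ W) :
    condMap p q f = (condIso hp V).hom ≫ f ≫ (condIso hq W).inv := dif_pos ⟨hp, hq⟩

lemma condMap_condIso_hom (hp : p) (hq : q) (f : V ⟶ W) :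
    condMap p q f ≫ (condIso hq W).hom = (condIso hp V).hom ≫ f := by
  simp [condMap_eq hp hq]

/-- If `p` or `r` fails, an outer object is zero, so the middle condition matters only when both
hold. In `resObj` the hypothesis becomes convexity. -/
lemma condMap_comp (h : p → r → q) (f : V ⟶ W) (g : W ⟶ X) :
    condMap p q f ≫ condMap q r g = condMap p r (f ≫ g) := by
  by_cases hp : p
  · by_cases hr : r
    · simp [condMap_eq hp (h hp hr), condMap_eq (h hp hr) hr, condMap_eq hp hr]
    · exact (isZero_condObj hr X).eq_of_tgt _ _
  · exact (isZero_condObj hp V).eq_of_src _ _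

lemma condMap_id : condMap p p (𝟙 V) = 𝟙 _ := by
  by_cases hp : p
  · simp [condMap_eq hp hp]
  · exact (isZero_condObj hp V).eq_of_src _ _

lemma condMap_add (f g : V ⟶ W) : condMap p q (f + g) = condMap p q f + condMap p q g := by
  by_cases h : p ∧ q
  · simp [condMap, h]
  · simp [condMap, h]

lemma condMap_zero : condMap p q (0 : V ⟶ W) = 0 := by
  by_cases h : p ∧ q <;> simp [condMap, h]

lemma condMap_smul (c : k) (f : V ⟶ W) : condMap p q (c • f) = c • condMap p q f := by
  by_cases h : p ∧ q <;> simp [condMap, h]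

lemma condMap_sum {ι : Type*} (s : Finset ι) (f : ι → (V ⟶ W)) :
    condMap p q (∑ i ∈ s, f i) = ∑ i ∈ s, condMap p q (f i) := by
  classical
  induction s using Finset.induction_on with
  | empty => simp [condMap_zero]
  | insert a s ha ih => rw [Finset.sum_insert ha, Finset.sum_insert ha, condMap_add, ih]

lemma isIso_condMap (h : p ↔ q) (f : V ⟶ W) [IsIso f] : IsIso (condMap p q f) := by
  by_cases hp : p
  · rw [condMap_eq hp (h.1 hp)]
    infer_instance
  · exact (isZero_condObj hp V).isIso (isZero_condObj (fun hq => hp (h.2 hq)) W) _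

end Indicator

/-! ### Restriction of representations to convex sets of vertices -/

section Restriction

variable {k : Type u} [Field k] {Q : Type v} [Quiver.{w} Q]

/-- `C` contains every vertex which lies on a path between two vertices of `C`. -/
def IsConvex (C : Set (Paths Q)) : Prop :=
  ∀ ⦃x y z : Paths Q⦄, (x ⟶ y) → (y ⟶ z) → x ∈ C → z ∈ C → y ∈ C

/-- The restriction of a representation to a convex set of vertices, extended by zero. -/
def resObj (C : Set (Paths Q)) (hC : IsConvex C) (V : QRep k Q) : QRep k Q where
  obj x := condObj (x ∈ C) (V.obj x)
  map {x y} f := condMap (x ∈ C) (y ∈ C) (V.map f)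
  map_id x := by rw [V.map_id, condMap_id]
  map_comp f g := by rw [V.map_comp, condMap_comp fun hx hz => hC f g hx hz]

/-- All paths in `r` share their endpoints, and the cut-off depends on the endpoints only and is
linear in the map. Hence restriction preserves every relation. -/
lemma relAct_resObj {C : Set (Paths Q)} (hC : IsConvex C) (V : QRep k Q) {a b : Q}
    (r : Quiver.Path a b →₀ k) :
    relAct (resObj C hC V) r = condMap _ _ (relAct V r) := by
  simp only [relAct, Finsupp.sum, condMap_sum, condMap_smul]
  rfl

variable (R : Relations k Q)

/-- The functor which restricts representations to a convex set of vertices. -/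
def res (C : Set (Paths Q)) (hC : IsConvex C) : RelRep R ⥤ RelRep R where
  obj V := ⟨resObj C hC V.obj, fun a b r hr => by
    rw [relAct_resObj, V.property a b r hr, condMap_zero]
    rfl⟩
  map f := ObjectProperty.homMk
    { app x := condMap (x ∈ C) (x ∈ C) (f.hom.app x)
      naturality x y p :=
        (condMap_comp (fun _ h => h) _ _).trans ((congrArg _ (f.hom.naturality p)).trans
          (condMap_comp (fun h _ => h) _ _).symm) }
  map_id V := by
    ext x : 3
    exact condMap_id
  map_comp f g := by
    ext x : 3
    exact (condMap_comp (fun h _ => h) _ _).symm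

variable {C C' : Set (Paths Q)} (hC : IsConvex C) (hC' : IsConvex C')

instance : (res R C hC).Additive where
  map_add {V W f g} := by
    ext x : 3
    exact condMap_add _ _

/-- At a vertex of `C`, the restriction to `C` is unchanged. -/
def resEvIso {x : Paths Q} (hx : x ∈ C) : res R C hC ⋙ ev R x ≅ ev R x :=
  NatIso.ofComponents (fun _ => condIso hx _) fun f =>
    condMap_condIso_hom hx hx (f.hom.app x)

lemma isZero_res_of_notMem {x : Paths Q} (hx : x ∉ C) (V : RelRep R) :
    IsZero ((ev R x).obj ((res R C hC).obj V)) := isZero_condObj hx _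

/-- Exactness is tested at each vertex, where the functor is either evaluation or zero. -/
instance : (res R C hC).PreservesHomology := by
  refine ((res R C hC).exact_tfae.out 1 2).1 fun S hS => exact_of_ev fun x => ?_
  by_cases hx : x ∈ C
  · exact (ShortComplex.exact_iff_of_iso (S.mapNatIso (resEvIso R hC hx))).2 (hS.map (ev R x))
  · exact ShortComplex.exact_of_isZero_X₂ _ (isZero_res_of_notMem R hC hx _)

instance : PreservesFiniteLimits (res R C hC) :=
  Functor.preservesFiniteLimits_of_preservesHomology _

instance : PreservesFiniteColimits (res R C hC) :=
  Functor.preservesFiniteColimits_of_preservesHomology _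

/-- The natural transformation between the restrictions to two sets of vertices. -/
def resTrans (h : ∀ ⦃x y : Paths Q⦄, (x ⟶ y) → x ∈ C → y ∈ C' → y ∈ C ∧ x ∈ C') :
    res R C hC ⟶ res R C' hC' where
  app V := ObjectProperty.homMk
    { app x := condMap _ _ (𝟙 _)
      naturality x y p :=
        (condMap_comp (fun hx hy => (h p hx hy).1) _ _).trans
          ((congrArg _ ((Category.comp_id _).trans (Category.id_comp _).symm)).trans
            (condMap_comp (fun hx hy => (h p hx hy).2) _ _).symm) }
  naturality V W f := by
    ext x : 3
    exact (condMap_comp (fun h _ => h) _ _).trans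
      ((congrArg _ ((Category.comp_id _).trans (Category.id_comp _).symm)).trans
        (condMap_comp (fun _ h => h) _ _).symm)

lemma isConvex_univ : IsConvex (Set.univ : Set (Paths Q)) := fun _ _ _ _ _ _ _ => trivial

/-- The restriction to the set of all vertices is the identity. -/
def resUnivIso : res R Set.univ isConvex_univ ≅ 𝟭 (RelRep R) :=
  NatIso.ofComponents (fun V => ObjectProperty.isoMk _
    (NatIso.ofComponents (fun x => condIso trivial _) fun p =>
      condMap_condIso_hom trivial trivial (V.obj.map p))) fun f => by
    ext x : 3
    exact condMap_condIso_hom trivial trivial (f.hom.app x)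

end Restriction

/-! ### Quivers without cycles: restriction to one vertex and simple representations -/

section Acyclic

variable {k : Type u} [Field k] {Q : Type v} [Quiver.{w} Q]

/-- `Q` has no non-trivial oriented cycles. -/
def NoCycles (Q : Type v) [Quiver.{w} Q] : Prop := ∀ (a : Q) (p : Quiver.Path a a), p.length = 0

variable (hQ : NoCycles Q)

lemma NoCycles.eq_of_paths (hQ : NoCycles Q) {x y : Paths Q} (p : x ⟶ y) (q : y ⟶ x) : y = x := by
  have h := (Quiver.Path.length_comp (V := Q) p q).symm.trans (hQ x _)
  exact (Quiver.Path.eq_of_length_zero p (by lia)).symm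

lemma NoCycles.eq_id (hQ : NoCycles Q) {x : Paths Q} (p : x ⟶ x) : p = 𝟙 x :=
  Quiver.Path.eq_nil_of_length_zero p (hQ x p)

lemma NoCycles.isConvex_singleton (hQ : NoCycles Q) (n : Paths Q) : IsConvex {n} := by
  rintro x y z p q rfl rfl
  exact hQ.eq_of_paths p q

/-- The vertices which are reachable from `n`. -/
def reachable (n : Paths Q) : Set (Paths Q) := {x | Nonempty (n ⟶ x)}

lemma isConvex_reachable (n : Paths Q) : IsConvex (reachable n) :=
  fun _ _ _ p _ ⟨q⟩ _ => ⟨q ≫ p⟩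

lemma self_mem_reachable (n : Paths Q) : n ∈ reachable n := ⟨𝟙 n⟩

variable (R : Relations k Q)

/-- The restriction of representations to a single vertex. -/
abbrev resAt (n : Paths Q) : RelRep R ⥤ RelRep R := res R {n} (hQ.isConvex_singleton n)

/-- The largest subrepresentation supported at the vertices which are reachable from `n`. -/
abbrev resReach (n : Paths Q) : RelRep R ⥤ RelRep R := res R (reachable n) (isConvex_reachable n)

/-- The inclusion of `resReach R n`. -/
def resReachι (n : Paths Q) : resReach R n ⟶ 𝟭 _ :=
  resTrans R _ isConvex_univ (fun _ _ p ⟨q⟩ _ => ⟨⟨q ≫ p⟩, trivial⟩) ≫ (resUnivIso R).hom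

/-- The projection of `resReach R n` to the vertex `n`. -/
def resReachπ (n : Paths Q) : resReach R n ⟶ resAt hQ R n :=
  resTrans R _ _ fun x y p ⟨q⟩ hy => by
    obtain rfl : y = n := hy
    exact ⟨self_mem_reachable _, (hQ.eq_of_paths q p)⟩

lemma isIso_ev_resReachι (n : Paths Q) {x : Paths Q} (hx : x ∈ reachable n) (V : RelRep R) :
    IsIso ((ev R x).map ((resReachι R n).app V)) := by
  rw [resReachι, NatTrans.comp_app, Functor.map_comp]
  have : IsIso ((ev R x).map ((resTrans R (isConvex_reachable n) isConvex_univ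
    (fun _ _ p ⟨q⟩ _ => ⟨⟨q ≫ p⟩, trivial⟩)).app V)) := isIso_condMap (iff_of_true hx trivial) _
  infer_instance

lemma isIso_ev_resReachπ (n : Paths Q) (V : RelRep R) :
    IsIso ((ev R n).map ((resReachπ hQ R n).app V)) :=
  isIso_condMap (iff_of_true (self_mem_reachable n) rfl) _

lemma isZero_ev_resReach {n x : Paths Q} (hx : x ∉ reachable n) (V : RelRep R) :
    IsZero ((ev R x).obj ((resReach R n).obj V)) := isZero_condObj hx _

lemma isZero_ev_resAt {n x : Paths Q} (hx : x ≠ n) (V : RelRep R) :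
    IsZero ((ev R x).obj ((resAt hQ R n).obj V)) := isZero_condObj hx _

/-- The restriction to `n` has the same value at `n`. -/
abbrev resAtEvIso (n : Paths Q) : resAt hQ R n ⋙ ev R n ≅ ev R n :=
  resEvIso R _ (Set.mem_singleton n)

variable {R}

/-- The source is zero at every other vertex. Thus identities between morphisms out of `resAt`
become identities of linear maps. -/
lemma resAt_hom_ext {n : Paths Q} {V W : RelRep R} {f g : (resAt hQ R n).obj V ⟶ W}
    (h : (ev R n).map f = (ev R n).map g) : f = g := by
  ext x : 3
  by_cases hx : x = n
  · subst hx
    exact h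
  · exact (isZero_ev_resAt hQ R hx V).eq_of_src _ _

open Classical in
/-- The morphism from the restriction of `V` to `n` which is given by a linear map whose image is
annihilated by all non-trivial paths. -/
def homOfAt {n : Paths Q} {V W : RelRep R} (φ : (ev R n).obj V ⟶ (ev R n).obj W)
    (h : ∀ (y : Paths Q) (p : n ⟶ y), y ≠ n → φ ≫ W.obj.map p = 0) :
    (resAt hQ R n).obj V ⟶ W :=
  ObjectProperty.homMk
    { app x := if hx : x = n then
          (condIso (p := x ∈ ({n} : Set (Paths Q))) hx (V.obj.obj x)).hom ≫
            V.obj.map (eqToHom hx) ≫ φ ≫ W.obj.map (eqToHom hx.symm)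
        else 0
      naturality x y p := by
        by_cases hx : x = n
        · subst hx
          by_cases hy : y = x
          · subst hy
            obtain rfl := hQ.eq_id p
            rw [CategoryTheory.Functor.map_id, CategoryTheory.Functor.map_id, Category.id_comp,
              Category.comp_id]
          · rw [(isZero_ev_resAt hQ R hy V).eq_of_tgt
              (((resAt hQ R x).obj V).obj.map p) 0, dif_pos rfl]
            simp only [eqToHom_refl, CategoryTheory.Functor.map_id, Category.id_comp, zero_comp]
            exact ((Category.assoc _ _ _).trans ((congrArg _ (h y p hy)).trans comp_zero)).symm
        · exact (isZero_ev_resAt hQ R hx V).eq_of_src _ _ }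

lemma ev_map_homOfAt {n : Paths Q} {V W : RelRep R} (φ : (ev R n).obj V ⟶ (ev R n).obj W)
    (h : ∀ (y : Paths Q) (p : n ⟶ y), y ≠ n → φ ≫ W.obj.map p = 0) :
    (ev R n).map (homOfAt hQ φ h) = (resAtEvIso hQ R n).hom.app V ≫ φ := by
  refine (dif_pos rfl).trans ?_
  simp
  rfl

/-- The morphism between restrictions to `n` given by a linear map. -/
def homResAt {n : Paths Q} {V W : RelRep R} (φ : (ev R n).obj V ⟶ (ev R n).obj W) :
    (resAt hQ R n).obj V ⟶ (resAt hQ R n).obj W :=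
  homOfAt hQ (φ ≫ (resAtEvIso hQ R n).inv.app W) fun _ _ hy =>
    (isZero_ev_resAt hQ R hy W).eq_of_tgt _ _

lemma ev_map_homResAt {n : Paths Q} {V W : RelRep R} (φ : (ev R n).obj V ⟶ (ev R n).obj W) :
    (ev R n).map (homResAt hQ φ) =
      (resAtEvIso hQ R n).hom.app V ≫ φ ≫ (resAtEvIso hQ R n).inv.app W :=
  ev_map_homOfAt _ _ _

lemma homResAt_comp {n : Paths Q} {V W X : RelRep R} (φ : (ev R n).obj V ⟶ (ev R n).obj W)
    (ψ : (ev R n).obj W ⟶ (ev R n).obj X) :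
    homResAt hQ φ ≫ homResAt hQ ψ = homResAt hQ (φ ≫ ψ) :=
  resAt_hom_ext hQ (by simp [ev_map_homResAt, -Functor.comp_map])

lemma homResAt_id {n : Paths Q} (V : RelRep R) :
    homResAt hQ (𝟙 ((ev R n).obj V)) = 𝟙 _ :=
  resAt_hom_ext hQ (by simp [ev_map_homResAt, -Functor.comp_map])

lemma homResAt_zero {n : Paths Q} (V W : RelRep R) :
    homResAt hQ (0 : (ev R n).obj V ⟶ (ev R n).obj W) = 0 :=
  resAt_hom_ext hQ (by simp [ev_map_homResAt, -Functor.comp_map])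

lemma homResAt_map {n : Paths Q} {V W : RelRep R} (f : V ⟶ W) :
    homResAt hQ ((ev R n).map f) = (resAt hQ R n).map f :=
  resAt_hom_ext hQ (by
    rw [ev_map_homResAt, ← NatTrans.naturality_assoc, Iso.hom_inv_id_app]
    exact Category.comp_id _)

section Simple

variable (R) [IsTensorRelations R]

/-- The simple representation at the vertex `n`. -/
abbrev simple (n : Paths Q) : RelRep R := (resAt hQ R n).obj (𝟙_ (RelRep R))

instance (n : Paths Q) : (ev R n).Linear k where
  map_smul _ _ := rfl

variable {R}

lemma unit_end_eq_smul (f : FGModuleCat.of k k ⟶ FGModuleCat.of k k) :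
    ∃ c : k, f = c • 𝟙 (FGModuleCat.of k k) := by
  refine ⟨f.hom.hom (1 : k), FGModuleCat.hom_ext (LinearMap.ext_ring ?_)⟩
  exact (mul_one (f.hom.hom (1 : k) : k)).symm

/-- The value at `n` is one-dimensional and determines the morphism. -/
lemma simple_end_eq_smul {n : Paths Q} (f : simple hQ R n ⟶ simple hQ R n) :
    ∃ c : k, f = c • 𝟙 _ := by
  let e := (resAtEvIso hQ R n).app (𝟙_ (RelRep R))
  obtain ⟨c, hc⟩ := unit_end_eq_smul (e.inv ≫ (ev R n).map f ≫ e.hom)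
  refine ⟨c, resAt_hom_ext hQ ?_⟩
  rw [Iso.inv_comp_eq, ← Iso.eq_comp_inv] at hc
  rw [hc, Functor.map_smul, CategoryTheory.Functor.map_id]
  erw [Linear.comp_smul, Linear.smul_comp, Category.comp_id, Iso.hom_inv_id]
  rfl

/-- Without cycles, reachability of a different vertex is a strict order, and it is well-founded
because `Q` is finite. -/
lemma exists_maximal_vertex [Finite Q] (hQ : NoCycles Q) (s : Set (Paths Q)) (hs : s.Nonempty) :
    ∃ n ∈ s, ∀ y ∈ s, Nonempty (n ⟶ y) → y = n := by
  let r : Paths Q → Paths Q → Prop := fun x y => Nonempty (y ⟶ x) ∧ x ≠ y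
  have : Finite (Paths Q) := ‹Finite Q›
  have : IsTrans (Paths Q) r := ⟨fun x y z ⟨⟨p⟩, h⟩ ⟨⟨q⟩, _⟩ => ⟨⟨q ≫ p⟩, fun e => by
    subst e
    exact h (hQ.eq_of_paths q p).symm⟩⟩
  have : Std.Irrefl r := ⟨fun x h => h.2 rfl⟩
  obtain ⟨n, hn, h⟩ := (Finite.wellFounded_of_trans_of_irrefl r).has_min s hs
  exact ⟨n, hn, fun y hy p => by_contra fun hne => h y hy ⟨p, hne⟩⟩

/-- At a sink `n` of the support of `V`, every path to another vertex acts by zero, so each nonzero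
vector at `n` spans a subrepresentation. -/
lemma exists_mono_simple [Finite Q] (hQ : NoCycles Q) {V : RelRep R} (hV : ¬ IsZero V) :
    ∃ (n : Paths Q) (f : simple hQ R n ⟶ V), Mono f := by
  obtain ⟨n, hn, h⟩ := exists_maximal_vertex hQ {x | ¬ IsZero ((ev R x).obj V)} (by
    by_contra hcon
    rw [Set.not_nonempty_iff_eq_empty, Set.eq_empty_iff_forall_notMem] at hcon
    exact hV (isZero_of_ev fun x => not_not.1 (hcon x)))
  have : Nontrivial ((ev R n).obj V) := by
    rw [← not_subsingleton_iff_nontrivial, ← isZero_iff_subsingleton]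
    exact hn
  obtain ⟨v, hv⟩ := exists_ne (0 : (ev R n).obj V)
  let φ : (ev R n).obj (𝟙_ (RelRep R)) ⟶ (ev R n).obj V :=
    FGModuleCat.ofHom (LinearMap.toSpanSingleton k _ v)
  have hφ : Mono φ := by
    refine (forget₂ (FGModuleCat k) (ModuleCat k)).mono_of_mono_map ?_
    rw [ModuleCat.mono_iff_injective]
    exact LinearMap.ker_eq_bot.1 (LinearMap.ker_toSpanSingleton k hv)
  refine ⟨n, homOfAt hQ φ fun y p hy => ?_, mono_of_ev _ fun x => ?_⟩
  · refine IsZero.eq_of_tgt (not_not.1 fun hz => hy (h y hz ⟨p⟩)) _ _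
  · by_cases hx : x = n
    · subst hx
      rw [ev_map_homOfAt]
      infer_instance
    · exact ⟨fun _ _ _ => (isZero_ev_resAt hQ R hx _).eq_of_tgt _ _⟩

end Simple

end Acyclic

/-! ### Tensor products of bounded complexes and monoidal functors -/

section TensorComplex

section Complexes

variable {A : Type*} [Category* A] [Abelian A]

lemma acyclic_of_homotopy {K : CochainComplex A ℤ} (h : Homotopy (𝟙 K) 0) : K.Acyclic := by
  intro i
  rw [HomologicalComplex.exactAt_iff_isZero_homology, IsZero.iff_id_eq_zero,
    ← HomologicalComplex.homologyMap_id, h.homologyMap_eq, HomologicalComplex.homologyMap_zero]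

variable {B : Type*} [Category* B] [Abelian B] (E : A ⥤ B) [E.Additive]

/-- The image of a complex under an additive functor. -/
abbrev mapComplex (K : CochainComplex A ℤ) : CochainComplex B ℤ :=
  (E.mapHomologicalComplex (ComplexShape.up ℤ)).obj K

lemma isBounded_mapComplex {K : CochainComplex A ℤ} (hK : IsBounded K) :
    IsBounded (mapComplex E K) := by
  obtain ⟨a, b, _, _⟩ := hK
  refine ⟨a, b, ?_, ?_⟩
  · rw [CochainComplex.isStrictlyGE_iff]
    exact fun i hi => E.map_isZero (K.isZero_of_isStrictlyGE a i hi)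
  · rw [CochainComplex.isStrictlyLE_iff]
    exact fun i hi => E.map_isZero (K.isZero_of_isStrictlyLE b i hi)

end Complexes

variable {A : Type u} [Category.{v} A] [Abelian A] [MonoidalCategory A] [MonoidalPreadditive A]

section Inclusions

variable {K L : CochainComplex A ℤ} (hK : IsBounded K) (hL : IsBounded L)

/-- The inclusion of a summand of the tensor product of two complexes. -/
def ιTensor (i j m : ℤ) (h : i + j = m) : K.X i ⊗ L.X j ⟶ (tensorComplex K L hK hL).X m :=
  haveI := hasMapBifunctor_of_isBounded hK hL
  HomologicalComplex.ιMapBifunctor K L (curriedTensor A) (ComplexShape.up ℤ) i j m h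

variable {hK hL} in
lemma tensor_hom_ext {m : ℤ} {X : A} {f g : (tensorComplex K L hK hL).X m ⟶ X}
    (h : ∀ (i j : ℤ) (hij : i + j = m), ιTensor hK hL i j m hij ≫ f = ιTensor hK hL i j m hij ≫ g) :
    f = g := by
  have := hasMapBifunctor_of_isBounded hK hL
  exact HomologicalComplex.mapBifunctor.hom_ext (K₁ := K) (K₂ := L) (F := curriedTensor A)
    (c := ComplexShape.up ℤ) h

/-- The morphism from the tensor product of complexes given by morphisms on the summands. -/
def tensorDesc {m : ℤ} {X : A} (f : ∀ (i j : ℤ), i + j = m → (K.X i ⊗ L.X j ⟶ X)) :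
    (tensorComplex K L hK hL).X m ⟶ X :=
  haveI := hasMapBifunctor_of_isBounded hK hL
  HomologicalComplex.mapBifunctorDesc (K₁ := K) (K₂ := L) (F := curriedTensor A)
    (c := ComplexShape.up ℤ) f

@[simp]
lemma ι_tensorDesc {m : ℤ} {X : A} (f : ∀ (i j : ℤ), i + j = m → (K.X i ⊗ L.X j ⟶ X))
    (i j : ℤ) (h : i + j = m) : ιTensor hK hL i j m h ≫ tensorDesc hK hL f = f i j h := by
  have := hasMapBifunctor_of_isBounded hK hL
  exact HomologicalComplex.ι_mapBifunctorDesc (K₁ := K) (K₂ := L) (F := curriedTensor A)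
    (c := ComplexShape.up ℤ) f i j h

@[simp]
lemma ι_tensorDesc_comp {m : ℤ} {X Y : A} (f : ∀ (i j : ℤ), i + j = m → (K.X i ⊗ L.X j ⟶ X))
    (i j : ℤ) (h : i + j = m) (g : X ⟶ Y) :
    ιTensor hK hL i j m h ≫ tensorDesc hK hL f ≫ g = f i j h ≫ g := by
  rw [← Category.assoc, ι_tensorDesc]

/-- The sign of the first differential. -/
abbrev sign₁ (i j : ℤ) : ℤˣ :=
  ComplexShape.ε₁ (ComplexShape.up ℤ) (ComplexShape.up ℤ) (ComplexShape.up ℤ) (i, j)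

/-- The sign of the second differential. -/
abbrev sign₂ (i j : ℤ) : ℤˣ :=
  ComplexShape.ε₂ (ComplexShape.up ℤ) (ComplexShape.up ℤ) (ComplexShape.up ℤ) (i, j)

lemma ιTensor_d (i j m m' : ℤ) (h : i + j = m) (hm : m + 1 = m') :
    ιTensor hK hL i j m h ≫ (tensorComplex K L hK hL).d m m' =
      sign₁ i j • (K.d i (i + 1) ▷ L.X j) ≫ ιTensor hK hL (i + 1) j m' (by lia) +
      sign₂ i j • (K.X i ◁ L.d j (j + 1)) ≫ ιTensor hK hL i (j + 1) m' (by lia) := by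
  have := hasMapBifunctor_of_isBounded hK hL
  dsimp only [tensorComplex, ιTensor]
  rw [HomologicalComplex.mapBifunctor.d_eq, Preadditive.comp_add,
    HomologicalComplex.mapBifunctor.ι_D₁, HomologicalComplex.mapBifunctor.ι_D₂,
    HomologicalComplex.mapBifunctor.d₁_eq _ _ _ _ (show (ComplexShape.up ℤ).Rel i (i + 1) from rfl)
      _ _ (show i + 1 + j = m' by lia),
    HomologicalComplex.mapBifunctor.d₂_eq _ _ _ _ _
      (show (ComplexShape.up ℤ).Rel j (j + 1) from rfl) _ (show i + (j + 1) = m' by lia)]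
  rfl

open Classical in
/-- The projection to a summand of the tensor product of two complexes. -/
def πTensor (i m : ℤ) : (tensorComplex K L hK hL).X m ⟶ K.X i ⊗ L.X (m - i) :=
  tensorDesc hK hL fun i' j' h => if hi : i' = i then
    eqToHom (by subst hi; obtain rfl : j' = m - i' := by lia
                rfl) else 0

lemma ι_πTensor_self (i m : ℤ) :
    ιTensor hK hL i (m - i) m (by lia) ≫ πTensor hK hL i m = 𝟙 _ := by
  simp [πTensor]

lemma ι_πTensor_of_ne (i i' j' m : ℤ) (h : i' + j' = m) (hi : i' ≠ i) :
    ιTensor hK hL i' j' m h ≫ πTensor hK hL i m = 0 := by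
  simp [πTensor, hi]

/-- Boundedness of `K` leaves finitely many nonzero summands. One finite set serves all degrees `m`,
and an additive functor respects the resulting identity. -/
lemma exists_sum_π_ι_eq_id : ∃ s : Finset ℤ, (∀ i ∉ s, IsZero (K.X i)) ∧ ∀ m,
    ∑ i ∈ s, πTensor hK hL i m ≫ ιTensor hK hL i (m - i) m (by lia) = 𝟙 _ := by
  obtain ⟨a, b, _, _⟩ := id hK
  have hz : ∀ i ∉ Finset.Icc a b, IsZero (K.X i) := fun i hi => by
    rw [Finset.mem_Icc, not_and_or, not_le, not_le] at hi
    exact hi.elim (fun h => K.isZero_of_isStrictlyGE a i h)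
      (fun h => K.isZero_of_isStrictlyLE b i h)
  refine ⟨Finset.Icc a b, hz, fun m => tensor_hom_ext fun i j h => ?_⟩
  by_cases hi : i ∈ Finset.Icc a b
  · obtain rfl : j = m - i := by lia
    rw [Preadditive.comp_sum, Finset.sum_eq_single_of_mem i hi fun i' _ hne => ?_]
    · rw [← Category.assoc, ι_πTensor_self, Category.id_comp, Category.comp_id]
    · rw [← Category.assoc, ι_πTensor_of_ne hK hL _ _ _ _ _ hne.symm, zero_comp]
  · exact (isZero_tensor_left (hz i hi)).eq_of_src _ _

end Inclusions

section Functoriality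

variable {K L K' L' : CochainComplex A ℤ} (hK : IsBounded K) (hL : IsBounded L)
  (hK' : IsBounded K') (hL' : IsBounded L')

/-- The tensor product of two morphisms of complexes. -/
def tensorMap (f : K ⟶ K') (g : L ⟶ L') :
    tensorComplex K L hK hL ⟶ tensorComplex K' L' hK' hL' :=
  haveI := hasMapBifunctor_of_isBounded hK hL
  haveI := hasMapBifunctor_of_isBounded hK' hL'
  HomologicalComplex.mapBifunctorMap f g (curriedTensor A) (ComplexShape.up ℤ)

lemma ι_tensorMap (f : K ⟶ K') (g : L ⟶ L') (i j m : ℤ) (h : i + j = m) :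
    ιTensor hK hL i j m h ≫ (tensorMap hK hL hK' hL' f g).f m =
      f.f i ▷ L.X j ≫ K'.X i ◁ g.f j ≫ ιTensor hK' hL' i j m h :=
  have := hasMapBifunctor_of_isBounded hK hL
  have := hasMapBifunctor_of_isBounded hK' hL'
  HomologicalComplex.ι_mapBifunctorMap f g (curriedTensor A) (ComplexShape.up ℤ) i j m h

lemma tensorMap_id : tensorMap hK hL hK hL (𝟙 K) (𝟙 L) = 𝟙 _ := by
  ext m
  refine tensor_hom_ext fun i j h => ?_
  rw [ι_tensorMap]
  simp

variable {K'' L'' : CochainComplex A ℤ} (hK'' : IsBounded K'') (hL'' : IsBounded L'')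

lemma tensorMap_comp (f : K ⟶ K') (g : L ⟶ L') (f' : K' ⟶ K'') (g' : L' ⟶ L'') :
    tensorMap hK hL hK'' hL'' (f ≫ f') (g ≫ g') =
      tensorMap hK hL hK' hL' f g ≫ tensorMap hK' hL' hK'' hL'' f' g' := by
  ext m
  refine tensor_hom_ext fun i j h => ?_
  rw [ι_tensorMap, HomologicalComplex.comp_f (tensorMap _ _ _ _ _ _),
    reassoc_of% (ι_tensorMap hK hL hK' hL' f g i j m h), ι_tensorMap]
  simp only [HomologicalComplex.comp_f, comp_whiskerRight, MonoidalCategory.whiskerLeft_comp,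
    Category.assoc, whisker_exchange_assoc]

lemma acyclic_tensorComplex_left (h : Homotopy (𝟙 K) 0) : (tensorComplex K L hK hL).Acyclic := by
  have := hasMapBifunctor_of_isBounded hK hL
  refine acyclic_of_homotopy (((Homotopy.ofEq (tensorMap_id hK hL).symm).trans
    (HomologicalComplex.mapBifunctorMapHomotopy₁ h (𝟙 L) (curriedTensor A)
      (ComplexShape.up ℤ))).trans (Homotopy.ofEq ?_))
  ext m i j h
  refine (ι_tensorMap hK hL hK hL 0 (𝟙 L) i j m h).trans ?_
  simp
  exact comp_zero.symm

lemma acyclic_tensorComplex_right (h : Homotopy (𝟙 L) 0) :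
    (tensorComplex K L hK hL).Acyclic := by
  have := hasMapBifunctor_of_isBounded hK hL
  refine acyclic_of_homotopy (((Homotopy.ofEq (tensorMap_id hK hL).symm).trans
    (HomologicalComplex.mapBifunctorMapHomotopy₂ (𝟙 K) h (curriedTensor A)
      (ComplexShape.up ℤ))).trans (Homotopy.ofEq ?_))
  ext m i j h
  refine (ι_tensorMap hK hL hK hL (𝟙 K) 0 i j m h).trans ?_
  simp
  exact comp_zero.symm

end Functoriality

section Comparison

variable {B : Type*} [Category* B] [Abelian B] [MonoidalCategory B]
  (E : A ⥤ B) [E.Additive] [E.Monoidal]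
  {K L : CochainComplex A ℤ} (hK : IsBounded K) (hL : IsBounded L)

/-- The inclusion of a summand of the image of a tensor product. -/
def ιMapTensor (i j m : ℤ) (h : i + j = m) :
    (mapComplex E K).X i ⊗ (mapComplex E L).X j ⟶ (mapComplex E (tensorComplex K L hK hL)).X m :=
  Functor.LaxMonoidal.μ E (K.X i) (L.X j) ≫ E.map (ιTensor hK hL i j m h)

/-- The projection to a summand of the image of a tensor product. -/
def πMapTensor (i m : ℤ) :
    (mapComplex E (tensorComplex K L hK hL)).X m ⟶
      (mapComplex E K).X i ⊗ (mapComplex E L).X (m - i) :=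
  E.map (πTensor hK hL i m) ≫ Functor.OplaxMonoidal.δ E (K.X i) (L.X (m - i))

lemma ιMapTensor_d (i j m m' : ℤ) (h : i + j = m) (hm : m + 1 = m') :
    ιMapTensor E hK hL i j m h ≫ (mapComplex E (tensorComplex K L hK hL)).d m m' =
      sign₁ i j • ((mapComplex E K).d i (i + 1) ▷ (mapComplex E L).X j) ≫
        ιMapTensor E hK hL (i + 1) j m' (by lia) +
      sign₂ i j • ((mapComplex E K).X i ◁ (mapComplex E L).d j (j + 1)) ≫
        ιMapTensor E hK hL i (j + 1) m' (by lia) := by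
  -- The goal with the terms of `mapComplex` unfolded, so that the naturality of `μ` can be applied.
  have h : (Functor.LaxMonoidal.μ E (K.X i) (L.X j) ≫ E.map (ιTensor hK hL i j m h)) ≫
      E.map ((tensorComplex K L hK hL).d m m') =
      sign₁ i j • (E.map (K.d i (i + 1)) ▷ E.obj (L.X j)) ≫
        Functor.LaxMonoidal.μ E (K.X (i + 1)) (L.X j) ≫
          E.map (ιTensor hK hL (i + 1) j m' (by lia)) +
      sign₂ i j • (E.obj (K.X i) ◁ E.map (L.d j (j + 1))) ≫
        Functor.LaxMonoidal.μ E (K.X i) (L.X (j + 1)) ≫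
          E.map (ιTensor hK hL i (j + 1) m' (by lia)) := by
    rw [Category.assoc, ← E.map_comp, ιTensor_d _ _ _ _ _ _ h hm,
      Functor.LaxMonoidal.μ_natural_left_assoc, Functor.LaxMonoidal.μ_natural_right_assoc]
    simp only [Functor.map_add, Functor.map_units_smul, Preadditive.comp_add,
      Linear.comp_units_smul, Functor.map_comp]
  exact h

lemma ι_πMapTensor_self (i m : ℤ) :
    ιMapTensor E hK hL i (m - i) m (by lia) ≫ πMapTensor E hK hL i m = 𝟙 _ := by
  have h : (Functor.LaxMonoidal.μ E (K.X i) (L.X (m - i)) ≫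
      E.map (ιTensor hK hL i (m - i) m (by lia))) ≫ E.map (πTensor hK hL i m) ≫
        Functor.OplaxMonoidal.δ E (K.X i) (L.X (m - i)) = 𝟙 _ := by
    rw [Category.assoc, ← E.map_comp_assoc, ι_πTensor_self]
    simp
  exact h

lemma ι_πMapTensor_of_ne (i i' j' m : ℤ) (h : i' + j' = m) (hi : i' ≠ i) :
    ιMapTensor E hK hL i' j' m h ≫ πMapTensor E hK hL i m = 0 := by
  have h : (Functor.LaxMonoidal.μ E (K.X i') (L.X j') ≫
      E.map (ιTensor hK hL i' j' m h)) ≫ E.map (πTensor hK hL i m) ≫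
        Functor.OplaxMonoidal.δ E (K.X i) (L.X (m - i)) = 0 := by
    rw [Category.assoc, ← E.map_comp_assoc, ι_πTensor_of_ne _ _ _ _ _ _ _ hi]
    simp
  exact h

lemma π_ιMapTensor (i m : ℤ) :
    πMapTensor E hK hL i m ≫ ιMapTensor E hK hL i (m - i) m (by lia) =
      E.map (πTensor hK hL i m ≫ ιTensor hK hL i (m - i) m (by lia)) := by
  have h : (E.map (πTensor hK hL i m) ≫ Functor.OplaxMonoidal.δ E (K.X i) (L.X (m - i))) ≫
      Functor.LaxMonoidal.μ E (K.X i) (L.X (m - i)) ≫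
        E.map (ιTensor hK hL i (m - i) m (by lia)) =
      E.map (πTensor hK hL i m ≫ ιTensor hK hL i (m - i) m (by lia)) := by
    simp
  exact h

variable [MonoidalPreadditive B]

/-- The comparison morphism between the tensor product of the images of two complexes and the
image of the tensor product. -/
def tensorComparison :
    tensorComplex _ _ (isBounded_mapComplex E hK) (isBounded_mapComplex E hL) ⟶
      mapComplex E (tensorComplex K L hK hL) where
  f m := tensorDesc _ _ fun i j h => ιMapTensor E hK hL i j m h
  comm' m m' hm := by
    refine tensor_hom_ext fun i j h => ?_
    rw [ι_tensorDesc_comp, ιMapTensor_d _ _ _ _ _ _ _ h hm, ← Category.assoc,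
      ιTensor_d _ _ _ _ _ _ h hm, Preadditive.add_comp, Linear.units_smul_comp,
      Linear.units_smul_comp, Category.assoc, Category.assoc, ι_tensorDesc, ι_tensorDesc]

/-- The inverse is the finite sum of projections followed by inclusions; no exactness of `E` enters.
-/
lemma isIso_tensorComparison : IsIso (tensorComparison E hK hL) := by
  obtain ⟨s, hs, hs'⟩ := exists_sum_π_ι_eq_id hK hL
  have (m : ℤ) : IsIso ((tensorComparison E hK hL).f m) := by
    refine ⟨∑ i ∈ s, πMapTensor E hK hL i m ≫
      ιTensor (isBounded_mapComplex E hK) (isBounded_mapComplex E hL)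
        i (m - i) m (by lia), tensor_hom_ext fun i j h => ?_, ?_⟩
    · by_cases hi : i ∈ s
      · obtain rfl : j = m - i := by lia
        rw [tensorComparison, ι_tensorDesc_comp, Preadditive.comp_sum,
          Finset.sum_eq_single_of_mem i hi fun i' _ hne => ?_]
        · rw [← Category.assoc, ι_πMapTensor_self, Category.id_comp, Category.comp_id]
        · rw [← Category.assoc, ι_πMapTensor_of_ne _ _ _ _ _ _ _ _ hne.symm, zero_comp]
      · exact (isZero_tensor_left (E.map_isZero (hs i hi))).eq_of_src _ _
    · rw [Preadditive.sum_comp, tensorComparison]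
      simp only [Category.assoc, ι_tensorDesc, π_ιMapTensor]
      exact (E.map_sum _ _).symm.trans ((congrArg E.map (hs' m)).trans (E.map_id _))
  exact HomologicalComplex.Hom.isIso_of_components _

end Comparison

end TensorComplex

/-! ### Complexes of vector spaces and the Künneth argument -/

section VectorSpaces

variable {k : Type u} [Field k]

instance (V : FGModuleCat.{u} k) : Injective V where
  factors {X Y} g f _ := by
    have hf : Function.Injective f.hom.hom :=
      (ModuleCat.mono_iff_injective ((forget₂ (FGModuleCat k) (ModuleCat k)).map f)).1 inferInstance
    obtain ⟨l, hl⟩ := f.hom.hom.exists_leftInverse_of_injective (LinearMap.ker_eq_bot.2 hf)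
    exact ⟨FGModuleCat.ofHom (g.hom.hom ∘ₗ l), FGModuleCat.hom_ext (by
      change (g.hom.hom ∘ₗ l) ∘ₗ f.hom.hom = _
      rw [LinearMap.comp_assoc, hl, LinearMap.comp_id])⟩

/-- Vector spaces are injective, so a bounded complex of them is K-injective, and acyclic
K-injective complexes are contractible. -/
lemma homotopy_zero_of_acyclic {K : CochainComplex (FGModuleCat.{u} k) ℤ} (hK : IsBounded K)
    (h : K.Acyclic) : Nonempty (Homotopy (𝟙 K) 0) := by
  obtain ⟨a, _, _, _⟩ := hK
  have := CochainComplex.isKInjective_of_injective K a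
  exact CochainComplex.IsKInjective.nonempty_homotopy_zero _ h

lemma exists_split_of_not_exact {S : ShortComplex (FGModuleCat.{u} k)} (h : ¬ S.Exact) :
    ∃ (z : FGModuleCat.of k k ⟶ S.X₂) (φ : S.X₂ ⟶ FGModuleCat.of k k),
      z ≫ S.g = 0 ∧ S.f ≫ φ = 0 ∧ z ≫ φ = 𝟙 _ := by
  rw [← S.exact_map_iff_of_faithful (forget₂ (FGModuleCat k) (ModuleCat k)),
    ShortComplex.moduleCat_exact_iff] at h
  push Not at h
  obtain ⟨x, hx, hx'⟩ : ∃ x : S.X₂, S.g.hom.hom x = 0 ∧ x ∉ LinearMap.range S.f.hom.hom := by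
    obtain ⟨x, hx, hx'⟩ := h
    exact ⟨x, hx, fun ⟨y, hy⟩ => hx' y hy⟩
  -- A functional that kills the boundaries but not the cycle `x`; dividing it by `f x` makes the
  -- composite with `x` equal to the identity.
  obtain ⟨f, hf, hf'⟩ := Submodule.exists_le_ker_of_notMem hx'
  refine ⟨FGModuleCat.ofHom (LinearMap.toSpanSingleton k S.X₂ x),
    FGModuleCat.ofHom ((f x)⁻¹ • f), FGModuleCat.hom_ext (LinearMap.ext_ring ?_),
    FGModuleCat.hom_ext (LinearMap.ext fun y => ?_), FGModuleCat.hom_ext (LinearMap.ext_ring ?_)⟩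
  · change S.g.hom.hom ((1 : k) • x) = 0
    rw [one_smul]
    exact hx
  · change (f x)⁻¹ • f (S.f.hom.hom y) = 0
    rw [LinearMap.mem_ker.1 (hf' ⟨y, rfl⟩), smul_zero]
  · change (f x)⁻¹ • f ((1 : k) • x) = 1
    rw [one_smul, smul_eq_mul, inv_mul_cancel₀ hf]

lemma exists_split_of_not_exactAt {K : CochainComplex (FGModuleCat.{u} k) ℤ} {i : ℤ}
    (h : ¬ K.ExactAt i) :
    ∃ (z : FGModuleCat.of k k ⟶ K.X i) (φ : K.X i ⟶ FGModuleCat.of k k),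
      (∀ j, z ≫ K.d i j = 0) ∧ (∀ j, K.d j i ≫ φ = 0) ∧ z ≫ φ = 𝟙 _ := by
  rw [K.exactAt_iff' (i - 1) i (i + 1) (by simp) (by simp)] at h
  obtain ⟨z, φ, h₁, h₂, h₃⟩ := exists_split_of_not_exact h
  refine ⟨z, φ, fun j => ?_, fun j => ?_, h₃⟩
  · by_cases hj : i + 1 = j
    · subst hj
      exact h₁
    · rw [K.shape _ _ hj]
      exact comp_zero
  · by_cases hj : j + 1 = i
    · obtain rfl : j = i - 1 := by lia
      exact h₂
    · rw [K.shape _ _ hj]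
      exact zero_comp

lemma isBounded_single {A : Type*} [Category* A] [Abelian A] (X : A) (i : ℤ) :
    IsBounded ((HomologicalComplex.single A (ComplexShape.up ℤ) i).obj X) :=
  ⟨i, i, inferInstance, inferInstance⟩

/-- An object which splits off from the cohomology in degree `i` splits off as a complex. -/
lemma retract_single {A : Type*} [Category* A] [Abelian A] {K : CochainComplex A ℤ} {i : ℤ} {X : A}
    (z : X ⟶ K.X i) (φ : K.X i ⟶ X) (h₁ : ∀ j, z ≫ K.d i j = 0) (h₂ : ∀ j, K.d j i ≫ φ = 0)
    (h₃ : z ≫ φ = 𝟙 _) :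
    Nonempty (Retract ((HomologicalComplex.single A (ComplexShape.up ℤ) i).obj X) K) := by
  refine ⟨⟨HomologicalComplex.mkHomFromSingle z fun j _ => h₁ j,
    HomologicalComplex.mkHomToSingle φ fun j _ => h₂ j,
    HomologicalComplex.from_single_hom_ext ?_⟩⟩
  simp [reassoc_of% h₃]

lemma ExactAt.of_retract {A : Type*} [Category* A] [Abelian A] {K L : CochainComplex A ℤ}
    (r : Retract K L) {i : ℤ} (h : L.ExactAt i) : K.ExactAt i := by
  rw [HomologicalComplex.exactAt_iff_isZero_homology] at h ⊢
  rw [IsZero.iff_id_eq_zero, ← HomologicalComplex.homologyMap_id, ← r.retract,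
    HomologicalComplex.homologyMap_comp, h.eq_of_tgt (HomologicalComplex.homologyMap r.i i) 0,
    zero_comp]

variable {A : Type u} [Category.{v} A] [Abelian A] [MonoidalCategory A] [MonoidalPreadditive A]

/-- The tensor product is concentrated in degree `i + j`, so exactness there kills that term, which
has `X ⊗ Y` as a direct summand. -/
lemma isZero_of_exactAt_tensor_single {X Y : A} {i j : ℤ}
    (h : (tensorComplex _ _ (isBounded_single X i) (isBounded_single Y j)).ExactAt (i + j)) :
    IsZero (X ⊗ Y) := by
  set T := tensorComplex _ _ (isBounded_single X i) (isBounded_single Y j)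
  have hT (m : ℤ) (hm : m ≠ i + j) : IsZero (T.X m) := by
    refine isZero_tensorComplex_X _ _ _ fun i' j' h' => ?_
    by_cases hi : i' = i
    · exact isZero_tensor_right (HomologicalComplex.isZero_single_obj_X _ _ _ _ (by lia))
    · exact isZero_tensor_left (HomologicalComplex.isZero_single_obj_X _ _ _ _ hi)
  rw [T.exactAt_iff' (i + j - 1) (i + j) (i + j + 1) (by simp) (by simp),
    ShortComplex.exact_iff_mono _ ((hT _ (by lia)).eq_of_src _ _)] at h
  have hz : IsZero (T.X (i + j)) := by
    have : Mono (T.d (i + j) (i + j + 1)) := h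
    rw [IsZero.iff_id_eq_zero, ← cancel_mono (T.d (i + j) (i + j + 1))]
    exact (hT _ (by lia)).eq_of_tgt _ _
  have hπ := ι_πTensor_self (isBounded_single X i) (isBounded_single Y j) i (i + j)
  rw [hz.eq_of_tgt (ιTensor _ _ _ _ _ _) 0, zero_comp] at hπ
  have h0 := (IsZero.iff_id_eq_zero _).2 hπ.symm
  refine h0.of_iso (MonoidalCategory.tensorIso
    (HomologicalComplex.singleObjXSelf (ComplexShape.up ℤ) i X)
    (HomologicalComplex.singleObjXIsoOfEq (ComplexShape.up ℤ) j Y (i + j - i) (by lia))).symm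

/-- Otherwise `k` in degree `i` and `k` in degree `j` are retracts of `K` and `L`. Their tensor
product is then a retract of an object exact in degree `i + j`, which forces `k ⊗ k = 0`. -/
lemma exactAt_of_exactAt_tensorComplex {K L : CochainComplex (FGModuleCat.{u} k) ℤ}
    (hK : IsBounded K) (hL : IsBounded L) (i j : ℤ)
    (h : (tensorComplex K L hK hL).ExactAt (i + j)) : K.ExactAt i ∨ L.ExactAt j := by
  by_contra! hcon
  obtain ⟨z, φ, h₁, h₂, h₃⟩ := exists_split_of_not_exactAt hcon.1
  obtain ⟨z', φ', h₁', h₂', h₃'⟩ := exists_split_of_not_exactAt hcon.2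
  obtain ⟨r⟩ := retract_single z φ h₁ h₂ h₃
  obtain ⟨r'⟩ := retract_single z' φ' h₁' h₂' h₃'
  have hz := isZero_of_exactAt_tensor_single (ExactAt.of_retract
    ⟨tensorMap (isBounded_single _ _) (isBounded_single _ _) hK hL r.i r'.i,
      tensorMap hK hL (isBounded_single _ _) (isBounded_single _ _) r.r r'.r, by
        rw [← tensorMap_comp, r.retract, r'.retract, tensorMap_id]⟩ h)
  have hs := (isZero_iff_subsingleton _).1 (hz.of_iso (λ_ (𝟙_ (FGModuleCat k))).symm)
  exact one_ne_zero (α := k) (hs.elim _ _)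

end VectorSpaces

/-! ### Tensor products at a vertex -/

section Kunneth

variable {k : Type u} [Field k] {Q : Type v} [Quiver.{w} Q] (R : Relations k Q)
  [IsTensorRelations R]

/-- The tensor product and its unit are computed vertex-wise, so the structure isomorphisms are
identities. -/
instance (n : Paths Q) : (ev R n).Monoidal :=
  Functor.CoreMonoidal.toMonoidal
    { εIso := Iso.refl _
      μIso _ _ := Iso.refl _ }

variable {R} {K L : CochainComplex (RelRep R) ℤ} (hK : IsBounded K) (hL : IsBounded L)
  (n : Paths Q)

lemma exactAt_ev_tensorComplex_iff (m : ℤ) :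
    (mapComplex (ev R n) (tensorComplex K L hK hL)).ExactAt m ↔
      (tensorComplex _ _ (isBounded_mapComplex (ev R n) hK)
        (isBounded_mapComplex (ev R n) hL)).ExactAt m := by
  have := isIso_tensorComparison (ev R n) hK hL
  exact ⟨fun h => h.of_iso (asIso (tensorComparison (ev R n) hK hL)).symm,
    fun h => h.of_iso (asIso (tensorComparison (ev R n) hK hL))⟩

lemma acyclic_ev_tensorComplex_left (h : (mapComplex (ev R n) K).Acyclic) :
    (mapComplex (ev R n) (tensorComplex K L hK hL)).Acyclic := fun m => by
  obtain ⟨h⟩ := homotopy_zero_of_acyclic (isBounded_mapComplex _ hK) h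
  exact (exactAt_ev_tensorComplex_iff hK hL n m).2 (acyclic_tensorComplex_left _ _ h m)

lemma acyclic_ev_tensorComplex_right (h : (mapComplex (ev R n) L).Acyclic) :
    (mapComplex (ev R n) (tensorComplex K L hK hL)).Acyclic := fun m => by
  obtain ⟨h⟩ := homotopy_zero_of_acyclic (isBounded_mapComplex _ hL) h
  exact (exactAt_ev_tensorComplex_iff hK hL n m).2 (acyclic_tensorComplex_right _ _ h m)

lemma acyclic_of_acyclic_ev_tensorComplex
    (h : (mapComplex (ev R n) (tensorComplex K L hK hL)).Acyclic) :
    (mapComplex (ev R n) K).Acyclic ∨ (mapComplex (ev R n) L).Acyclic := by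
  by_contra! hcon
  simp only [HomologicalComplex.Acyclic, not_forall] at hcon
  obtain ⟨⟨i, hi⟩, ⟨j, hj⟩⟩ := hcon
  exact (exactAt_of_exactAt_tensorComplex _ _ i j
    ((exactAt_ev_tensorComplex_iff hK hL n _).1 (h _))).elim hi hj

end Kunneth

/-! ### Cohomology at a vertex and the ideals `vanishesAt` -/

section QuasiIsomorphisms

lemma isZero_of_retract {C : Type*} [Category* C] [HasZeroMorphisms C] {X Y : C}
    (r : Retract X Y) (hY : IsZero Y) : IsZero X := by
  rw [IsZero.iff_id_eq_zero, ← r.retract, hY.eq_of_tgt r.i 0, zero_comp]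

variable {k : Type u} [Field k] {Q : Type v} [Quiver.{w} Q] {R : Relations k Q}

lemma isIso_of_ev {V W : RelRep R} (f : V ⟶ W) (h : ∀ n, IsIso ((ev R n).map f)) : IsIso f := by
  have (n : Paths Q) : IsIso (f.hom.app n) := h n
  have : IsIso ((satisfies R).ι.map f) := NatIso.isIso_of_isIso_app f.hom
  exact isIso_of_fully_faithful (satisfies R).ι f

lemma quasiIso_of_ev {S₁ S₂ : ShortComplex (RelRep R)} (φ : S₁ ⟶ S₂)
    (h : ∀ n, ShortComplex.QuasiIso ((ev R n).mapShortComplex.map φ)) :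
    ShortComplex.QuasiIso φ := by
  have γ : ShortComplex.LeftHomologyMapData φ S₁.leftHomologyData S₂.leftHomologyData := default
  rw [γ.quasiIso_iff]
  exact isIso_of_ev _ fun n => (γ.quasiIso_map_iff (ev R n)).1 (h n)

/-- A morphism of complexes is a quasi-isomorphism if it is an isomorphism or a morphism of
acyclic complexes at every vertex. -/
lemma quasiIso_of_forall_ev {K L : CochainComplex (RelRep R) ℤ} (f : K ⟶ L)
    (h : ∀ n, (∀ i, IsIso ((ev R n).map (f.f i))) ∨
      ((mapComplex (ev R n) K).Acyclic ∧ (mapComplex (ev R n) L).Acyclic)) : QuasiIso f where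
  quasiIsoAt i := by
    rw [quasiIsoAt_iff]
    refine quasiIso_of_ev _ fun n => ?_
    rcases h n with h | ⟨h₁, h₂⟩
    · have (j : ℤ) := h j
      set φ := (ev R n).mapShortComplex.map
        ((HomologicalComplex.shortComplexFunctor (RelRep R) (ComplexShape.up ℤ) i).map f)
      have : IsIso φ.τ₁ := h _
      have : IsIso φ.τ₂ := h _
      have : IsIso φ.τ₃ := h _
      have : IsIso φ := ShortComplex.isIso_of_isIso φ
      infer_instance
    · exact ⟨((h₁ i).isZero_homology).isIso ((h₂ i).isZero_homology) _⟩

variable (n : Paths Q)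

lemma isZero_ev_homology_iff (K : CochainComplex (RelRep R) ℤ) (i : ℤ) :
    IsZero ((ev R n).obj ((DerivedCategory.homologyFunctor (RelRep R) i).obj
      (DerivedCategory.Q.obj K))) ↔ (mapComplex (ev R n) K).ExactAt i := by
  refine (((ev R n).mapIso
    ((DerivedCategory.homologyFunctorFactors (RelRep R) i).app K)).isZero_iff).trans ?_
  change _ ↔ ((K.sc i).map (ev R n)).Exact
  rw [ShortComplex.exact_iff_isZero_homology, ((K.sc i).mapHomologyIso (ev R n)).isZero_iff]
  rfl

/-- The objects of `D(Q)` whose cohomology vanishes at the vertex `n`. -/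
def vanishesAt (n : Paths Q) : ObjectProperty (D R) := fun V =>
  ∀ i : ℤ, IsZero ((ev R n).obj ((DerivedCategory.homologyFunctor (RelRep R) i).obj V.obj))

lemma vanishesAt_iff {V : D R} {K : CochainComplex (RelRep R) ℤ}
    (e : V.obj ≅ DerivedCategory.Q.obj K) :
    vanishesAt n V ↔ (mapComplex (ev R n) K).Acyclic :=
  forall_congr' fun i => ((DerivedCategory.homologyFunctor (RelRep R) i ⋙
    ev R n).mapIso e).isZero_iff.trans (isZero_ev_homology_iff n K i)

/-- The cohomology of degree zero at the vertex `n`. -/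
abbrev homologyAt (n : Paths Q) : D R ⥤ FGModuleCat k :=
  (DerivedCategory.Bounded.ι ⋙ DerivedCategory.homologyFunctor (RelRep R) 0) ⋙ ev R n

instance : (homologyAt (R := R) n).IsHomological where
  exact T hT := ((DerivedCategory.Bounded.ι ⋙
    DerivedCategory.homologyFunctor (RelRep R) 0).map_distinguished_exact T hT).map (ev R n)

/-- Cohomology in degree `i` is cohomology in degree zero of a shift. As a homological kernel, the
subcategory is triangulated. -/
lemma vanishesAt_eq_homologicalKernel :
    vanishesAt (R := R) n = (homologyAt n).homologicalKernel := by
  ext V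
  refine forall_congr' fun i => Iso.isZero_iff ((ev R n).mapIso ?_)
  exact (((DerivedCategory.homologyFunctor (RelRep R) 0).isoShift i).app V.obj).symm ≪≫
    (DerivedCategory.homologyFunctor (RelRep R) 0).mapIso
      ((DerivedCategory.Bounded.ι.commShiftIso i).app V).symm

instance : (vanishesAt (R := R) n).IsTriangulated := by
  rw [vanishesAt_eq_homologicalKernel]
  infer_instance

instance : (vanishesAt (R := R) n).IsClosedUnderIsomorphisms := by
  rw [vanishesAt_eq_homologicalKernel]
  infer_instance

instance : (vanishesAt (R := R) n).IsStableUnderRetracts where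
  of_retract r hY i := isZero_of_retract (r.map (DerivedCategory.Bounded.ι ⋙
      DerivedCategory.homologyFunctor (RelRep R) i ⋙ ev R n)) (hY i)

lemma isZero_of_vanishesAt {V : D R} (h : ∀ n, vanishesAt n V) : IsZero V := by
  have hz (i : ℤ) : IsZero ((DerivedCategory.homologyFunctor (RelRep R) i).obj V.obj) :=
    isZero_of_ev fun n => h n i
  have : IsIso (0 : V.obj ⟶ 0) := by
    rw [DerivedCategory.isIso_iff]
    exact fun i => (hz i).isIso (Functor.map_isZero _ (isZero_zero _)) _
  rw [IsZero.iff_id_eq_zero]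
  exact DerivedCategory.Bounded.ι.map_injective
    (((isZero_zero _).of_iso (asIso (0 : V.obj ⟶ 0))).eq_of_src _ _)

lemma vanishesAt_iff_representative (V : D R) :
    vanishesAt n V ↔ (mapComplex (ev R n) (representative V)).Acyclic :=
  vanishesAt_iff n (exists_bounded_representative V).choose_spec.2.some

section Tensor

variable [IsTensorRelations R]

lemma vanishesAt_tensorObj_iff (V W : D R) :
    vanishesAt n (tensorObj V W) ↔
      (mapComplex (ev R n) (tensorComplex (representative V) (representative W)
        (isBounded_representative V) (isBounded_representative W))).Acyclic :=
  vanishesAt_iff n (Iso.refl _)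

lemma vanishesAt_tensorObj_left {V : D R} (h : vanishesAt n V) (W : D R) :
    vanishesAt n (tensorObj V W) :=
  (vanishesAt_tensorObj_iff n V W).2
    (acyclic_ev_tensorComplex_left _ _ n ((vanishesAt_iff_representative n V).1 h))

lemma vanishesAt_tensorObj_right (V : D R) {W : D R} (h : vanishesAt n W) :
    vanishesAt n (tensorObj V W) :=
  (vanishesAt_tensorObj_iff n V W).2
    (acyclic_ev_tensorComplex_right _ _ n ((vanishesAt_iff_representative n W).1 h))

lemma vanishesAt_or_of_tensorObj {V W : D R} (h : vanishesAt n (tensorObj V W)) :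
    vanishesAt n V ∨ vanishesAt n W :=
  (acyclic_of_acyclic_ev_tensorComplex _ _ n ((vanishesAt_tensorObj_iff n V W).1 h)).imp
    (vanishesAt_iff_representative n V).2 (vanishesAt_iff_representative n W).2

variable (R) in
/-- The simple object at the vertex `n`, in degree `i`. -/
def simpleObj (hQ : NoCycles Q) (n : Paths Q) (i : ℤ) : D R :=
  ofComplex ((HomologicalComplex.single (RelRep R) (ComplexShape.up ℤ) i).obj (simple hQ R n))
    (isBounded_single _ _)

variable (hQ : NoCycles Q)

lemma vanishesAt_simpleObj {m : Paths Q} (h : m ≠ n) (i : ℤ) :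
    vanishesAt m (simpleObj R hQ n i) := by
  refine (vanishesAt_iff m (Iso.refl _)).2 fun j => HomologicalComplex.ExactAt.of_isZero ?_
  by_cases hj : j = i
  · subst hj
    exact (isZero_ev_resAt hQ R h _).of_iso ((ev R m).mapIso
      (HomologicalComplex.singleObjXSelf (ComplexShape.up ℤ) j (simple hQ R n)))
  · exact (ev R m).map_isZero (HomologicalComplex.isZero_single_obj_X _ _ _ _ hj)

lemma not_isZero_ev_simple : ¬ IsZero ((ev R n).obj (simple hQ R n)) := fun h => by
  have h := h.of_iso ((resAtEvIso hQ R n).app (𝟙_ (RelRep R))).symm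
  have := (isZero_iff_subsingleton _).1 h
  exact one_ne_zero (α := k) (this.elim (α := k) _ _)

lemma not_vanishesAt_simpleObj (i : ℤ) : ¬ vanishesAt n (simpleObj R hQ n i) := fun h => by
  refine not_isZero_ev_simple n hQ ((h i).of_iso ((ev R n).mapIso ?_))
  exact ((DerivedCategory.singleFunctorCompHomologyFunctorIso (RelRep R) i).app _).symm

/-- The objects `simpleObj R hQ n i` for varying `i` are shifts of each other, so degree zero
represents them all. -/
lemma simpleObj_mem (J : ObjectProperty (D R)) [J.IsStableUnderShift ℤ]
    [J.IsClosedUnderIsomorphisms] {i : ℤ} (j : ℤ) (h : J (simpleObj R hQ n i)) :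
    J (simpleObj R hQ n j) := by
  refine J.prop_of_iso (Functor.preimageIso DerivedCategory.Bounded.ι ?_)
    (J.le_shift (i - j) _ h)
  exact (DerivedCategory.Bounded.ι.commShiftIso (i - j)).app _ ≪≫
    ((DerivedCategory.singleFunctors (RelRep R)).shiftIso (i - j) j i (by lia)).app _

end Tensor

end QuasiIsomorphisms

/-! ### Classification of the prime ideals -/

section Primes

variable {k : Type u} [Field k] {Q : Type v} [Quiver.{w} Q] {R : Relations k Q}

section Retract

variable (hQ : NoCycles Q) (n : Paths Q)

/-- The inclusion of `resReach R n` for complexes. -/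
abbrev complexι (K : CochainComplex (RelRep R) ℤ) : mapComplex (resReach R n) K ⟶ K where
  f i := (resReachι R n).app (K.X i)
  comm' i j _ := ((resReachι R n).naturality (K.d i j)).symm

/-- The projection of `resReach R n` to the vertex `n` for complexes. -/
abbrev complexπ (K : CochainComplex (RelRep R) ℤ) :
    mapComplex (resReach R n) K ⟶ mapComplex (resAt hQ R n) K :=
  (NatTrans.mapHomologicalComplex (resReachπ hQ R n) (ComplexShape.up ℤ)).app K

lemma acyclic_of_isZero {C : Type*} [Category* C] [Abelian C] {K : CochainComplex C ℤ}
    (h : ∀ i, IsZero (K.X i)) : K.Acyclic :=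
  fun i => HomologicalComplex.ExactAt.of_isZero (h i)

variable {n}

/-- The inclusion is an isomorphism at reachable vertices. Any other vertex differs from `n`, so
there `K` is acyclic by hypothesis, and the subcomplex is zero. -/
lemma quasiIso_complexι {K : CochainComplex (RelRep R) ℤ}
    (h : ∀ m ≠ n, (mapComplex (ev R m) K).Acyclic) : QuasiIso (complexι n K) := by
  refine quasiIso_of_forall_ev _ fun m => ?_
  by_cases hm : m ∈ reachable n
  · exact Or.inl fun i => isIso_ev_resReachι R n hm (K.X i)
  · refine Or.inr ⟨acyclic_of_isZero fun i => isZero_ev_resReach R hm (K.X i), h m ?_⟩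
    rintro rfl
    exact hm (self_mem_reachable m)

lemma quasiIso_complexπ {K : CochainComplex (RelRep R) ℤ}
    (h : ∀ m ≠ n, (mapComplex (ev R m) (mapComplex (resReach R n) K)).Acyclic) :
    QuasiIso (complexπ hQ n K) := by
  refine quasiIso_of_forall_ev _ fun m => ?_
  by_cases hm : m = n
  · subst hm
    exact Or.inl fun i => isIso_ev_resReachπ hQ R m (K.X i)
  · exact Or.inr ⟨h m hm, acyclic_of_isZero fun i => isZero_ev_resAt hQ R hm (K.X i)⟩

/-- An object whose cohomology is concentrated at the vertex `n` is represented by a complex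
which is concentrated at `n`. -/
lemma exists_iso_resAt {X : D R} (h : ∀ m ≠ n, vanishesAt m X) :
    ∃ K : CochainComplex (RelRep R) ℤ, Nonempty (X.obj ≅ DerivedCategory.Q.obj K) ∧
      Nonempty (X.obj ≅ DerivedCategory.Q.obj (mapComplex (resAt hQ R n) K)) := by
  obtain ⟨K, _, ⟨e⟩⟩ := exists_bounded_representative X
  have := quasiIso_complexι fun m hm => (vanishesAt_iff m e).1 (h m hm)
  have e' := e ≪≫ (asIso (DerivedCategory.Q.map (complexι n K))).symm
  -- By `e'` the subcomplex also represents `X`, so it inherits the vanishing away from `n`.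
  have := quasiIso_complexπ hQ fun m hm => (vanishesAt_iff m e').1 (h m hm)
  exact ⟨K, ⟨e⟩, ⟨e' ≪≫ asIso (DerivedCategory.Q.map (complexπ hQ n K))⟩⟩

variable [IsTensorRelations R]

/-- A complex concentrated at `n` is a complex of vector spaces: `homResAt` lifts the splitting of a
cohomology class there to representations. -/
lemma retract_of_not_vanishesAt {X : D R} (h : ∀ m ≠ n, vanishesAt m X)
    (hX : ¬ vanishesAt n X) : ∃ i, Nonempty (Retract (simpleObj R hQ n i) X) := by
  obtain ⟨K, ⟨e⟩, ⟨e'⟩⟩ := exists_iso_resAt hQ h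
  rw [vanishesAt_iff n e, HomologicalComplex.Acyclic, not_forall] at hX
  obtain ⟨i, hi⟩ := hX
  obtain ⟨z, φ, h₁, h₂, h₃⟩ := exists_split_of_not_exactAt hi
  obtain ⟨r⟩ := retract_single (K := mapComplex (resAt hQ R n) K) (X := simple hQ R n)
    (homResAt hQ (V := 𝟙_ (RelRep R)) (W := K.X i) z)
    (homResAt hQ (V := K.X i) (W := 𝟙_ (RelRep R)) φ)
    (fun j => by
      refine (congrArg (_ ≫ ·) (homResAt_map hQ (K.d i j)).symm).trans ?_
      exact (homResAt_comp hQ _ _).trans ((congrArg _ (h₁ j)).trans (homResAt_zero hQ _ _)))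
    (fun j => by
      refine (congrArg (· ≫ _) (homResAt_map hQ (K.d j i)).symm).trans ?_
      exact (homResAt_comp hQ _ _).trans ((congrArg _ (h₂ j)).trans (homResAt_zero hQ _ _)))
    ((homResAt_comp hQ _ _).trans ((congrArg _ h₃).trans (homResAt_id hQ _)))
  have r' := r.map DerivedCategory.Q
  refine ⟨i, ⟨⟨⟨r'.i ≫ e'.inv⟩, ⟨e'.hom ≫ r'.r⟩, ?_⟩⟩⟩
  ext
  change (r'.i ≫ e'.inv) ≫ e'.hom ≫ r'.r = 𝟙 _
  rw [Category.assoc, Iso.inv_hom_id_assoc]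
  exact r'.retract

end Retract

section Devissage

lemma ofComplex_mem_of_shortExact {A : Type*} [Category* A] [Abelian A]
    [HasDerivedCategory A] (J : ObjectProperty (DerivedCategory.Bounded A)) [J.IsTriangulated]
    [J.IsClosedUnderIsomorphisms] {S : ShortComplex (CochainComplex A ℤ)} (hS : S.ShortExact)
    (h₁ : IsBounded S.X₁) (h₂ : IsBounded S.X₂) (h₃ : IsBounded S.X₃)
    (hJ₁ : J (ofComplex S.X₁ h₁)) (hJ₃ : J (ofComplex S.X₃ h₃)) : J (ofComplex S.X₂ h₂) := by
  -- The triangle of the short exact sequence lives in the unbounded category, so `J` is replaced by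
  -- its image there.
  have h := ObjectProperty.ext_of_isTriangulatedClosed₂ (J.map DerivedCategory.Bounded.ι) _
    (DerivedCategory.triangleOfSES_distinguished hS) (J.prop_map_obj _ hJ₁) (J.prop_map_obj _ hJ₃)
  rw [ObjectProperty.prop_map_iff] at h
  obtain ⟨Y, hY, ⟨e⟩⟩ := h
  exact J.prop_of_iso (Functor.preimageIso DerivedCategory.Bounded.ι e) hY

/-- The total dimension of a representation. -/
def totalDim (V : RelRep R) : ℕ :=
  ∑ᶠ n : Q, Module.finrank k ((ev R ((Paths.of Q).obj n)).obj V)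

instance (n : Paths Q) : PreservesFiniteLimits (ev R n) :=
  Functor.preservesFiniteLimits_of_preservesHomology _

instance (n : Paths Q) : PreservesFiniteColimits (ev R n) :=
  Functor.preservesFiniteColimits_of_preservesHomology _

lemma finrank_add_of_shortExact {S : ShortComplex (FGModuleCat.{u} k)} (hS : S.ShortExact) :
    Module.finrank k S.X₂ = Module.finrank k S.X₁ + Module.finrank k S.X₃ := by
  let S' := S.map (forget₂ (FGModuleCat k) (ModuleCat k))
  have : Module.Finite k S'.X₁ := inferInstanceAs (Module.Finite k S.X₁)
  have : Module.Finite k S'.X₃ := inferInstanceAs (Module.Finite k S.X₃)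
  exact ModuleCat.free_shortExact_finrank_add
    (hS.map_of_exact (forget₂ (FGModuleCat k) (ModuleCat k))) rfl rfl

lemma totalDim_add [Finite Q] {S : ShortComplex (RelRep R)} (hS : S.ShortExact) :
    totalDim S.X₂ = totalDim S.X₁ + totalDim S.X₃ := by
  rw [totalDim, totalDim, totalDim, ← finsum_add_distrib (Set.toFinite _) (Set.toFinite _)]
  exact finsum_congr fun n => finrank_add_of_shortExact
    (hS.map_of_exact (ev R ((Paths.of Q).obj n)))

lemma totalDim_pos [Finite Q] {V : RelRep R} (hV : ¬ IsZero V) : 0 < totalDim V := by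
  by_contra! h
  refine hV (isZero_of_ev fun n => (isZero_iff_subsingleton _).2 ?_)
  have h₀ : Module.finrank k ((ev R n).obj V) = 0 := by
    by_contra hne
    exact (finsum_pos (f := fun n : Q => Module.finrank k ((ev R ((Paths.of Q).obj n)).obj V))
      (fun _ => Nat.zero_le _) ⟨n, Nat.pos_of_ne_zero hne⟩ (Set.toFinite _)).not_ge h
  exact Module.finrank_zero_iff.1 h₀

variable [Finite Q] [IsTensorRelations R] (hQ : NoCycles Q)

/-- In the highest nonzero degree the outgoing differential vanishes, so a simple subobject of that
term is a subcomplex. -/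
lemma exists_shortExact_single {K : CochainComplex (RelRep R) ℤ} {a b : ℤ}
    (hb : K.IsStrictlyLE b) (hK : ∃ i ∈ Finset.Icc a b, ¬ IsZero (K.X i)) :
    ∃ i ∈ Finset.Icc a b, ∃ (n : Paths Q) (S : ShortComplex (CochainComplex (RelRep R) ℤ)),
      S.ShortExact ∧ S.X₁ = (HomologicalComplex.single (RelRep R) (ComplexShape.up ℤ) i).obj
        (simple hQ R n) ∧ S.X₂ = K := by
  classical
  let s := (Finset.Icc a b).filter fun i => ¬ IsZero (K.X i)
  have hs : s.Nonempty := hK.imp fun i hi => Finset.mem_filter.2 hi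
  obtain ⟨i, hi, hmax⟩ := s.exists_maximal hs
  rw [Finset.mem_filter] at hi
  have hz (j : ℤ) (hj : i < j) : IsZero (K.X j) := by
    by_contra hne
    by_cases hjb : j ≤ b
    · have hj' : j ∈ s := Finset.mem_filter.2 ⟨Finset.mem_Icc.2
        ⟨(Finset.mem_Icc.1 hi.1).1.trans hj.le, hjb⟩, hne⟩
      exact absurd (hmax hj' hj.le) (not_le.2 hj)
    · exact hne (K.isZero_of_isStrictlyLE b j (by lia))
  obtain ⟨n, f, hf⟩ := exists_mono_simple hQ hi.2
  let g := HomologicalComplex.mkHomFromSingle (c := ComplexShape.up ℤ) f fun j hj => by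
    simp only [ComplexShape.up_Rel] at hj
    exact (hz j (by lia)).eq_of_tgt _ _
  have (j : ℤ) : Mono (g.f j) := by
    by_cases hj : j = i
    · subst hj
      rw [HomologicalComplex.mkHomFromSingle_f]
      infer_instance
    · exact ⟨fun _ _ _ => (HomologicalComplex.isZero_single_obj_X _ _ _ _ hj).eq_of_tgt _ _⟩
  have : Mono g := HomologicalComplex.mono_of_mono_f g this
  exact ⟨i, hi.1, n, ShortComplex.mk g (cokernel.π g) (cokernel.condition g),
    ⟨ShortComplex.exact_cokernel g⟩, rfl, rfl⟩

/-- An isomorphism-closed triangulated subcategory which contains the simple objects contains all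
objects. -/
lemma forall_mem_of_simpleObj_mem (J : ObjectProperty (D R)) [J.IsTriangulated]
    [J.IsClosedUnderIsomorphisms] (hJ : ∀ n, J (simpleObj R hQ n 0)) (V : D R) : J V := by
  -- Induction on the total dimension of all terms, with the bounds `a` and `b` fixed: the quotient
  -- by a simple subcomplex stays within them.
  have key (a b : ℤ) (N : ℕ) : ∀ (K : CochainComplex (RelRep R) ℤ) (hK : IsBounded K),
      K.IsStrictlyGE a → K.IsStrictlyLE b → ∑ i ∈ Finset.Icc a b, totalDim (K.X i) = N →
        J (ofComplex K hK) := by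
    induction N using Nat.strong_induction_on with
    | _ N ih =>
      intro K hK ha hb hN
      by_cases h : ∃ i ∈ Finset.Icc a b, ¬ IsZero (K.X i)
      · obtain ⟨i, hi, n, S, hS, hS₁, hS₂⟩ := exists_shortExact_single hQ hb h
        subst hS₂
        have hS' (j : ℤ) := hS.map_of_exact
          (HomologicalComplex.eval (RelRep R) (ComplexShape.up ℤ) j)
        have hz (j : ℤ) (hj : IsZero (S.X₂.X j)) : IsZero (S.X₃.X j) := by
          have : Epi (S.g.f j) := (hS' j).epi_g
          exact IsZero.of_epi (S.g.f j) hj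
        have ha₃ : S.X₃.IsStrictlyGE a := (CochainComplex.isStrictlyGE_iff _ _).2
          fun j hj => hz j (S.X₂.isZero_of_isStrictlyGE a j hj)
        have hb₃ : S.X₃.IsStrictlyLE b := (CochainComplex.isStrictlyLE_iff _ _).2
          fun j hj => hz j (S.X₂.isZero_of_isStrictlyLE b j hj)
        have hb₁ : IsBounded S.X₁ := hS₁ ▸ isBounded_single _ _
        refine ofComplex_mem_of_shortExact J hS hb₁ hK ⟨a, b, ha₃, hb₃⟩ ?_
          (ih _ ?_ _ _ ha₃ hb₃ rfl)
        · refine J.prop_of_iso (Functor.preimageIso DerivedCategory.Bounded.ι ?_)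
            (simpleObj_mem n hQ J i (hJ n))
          exact DerivedCategory.Q.mapIso (eqToIso hS₁.symm)
        · have hd (j : ℤ) : totalDim (S.X₂.X j) = totalDim (S.X₁.X j) + totalDim (S.X₃.X j) :=
            totalDim_add (hS' j)
          rw [← hN, Finset.sum_congr rfl fun j _ => hd j, Finset.sum_add_distrib]
          refine lt_add_of_pos_left _ (Finset.sum_pos' (fun _ _ => Nat.zero_le _) ⟨i, hi, ?_⟩)
          refine totalDim_pos fun hz => not_isZero_ev_simple n hQ ((ev R n).map_isZero ?_)
          have hz : IsZero (S.X₁.X i) := hz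
          rw [hS₁] at hz
          exact hz.of_iso (HomologicalComplex.singleObjXSelf _ i _).symm
      · push Not at h
        have hz (i : ℤ) : IsZero (K.X i) := by
          by_cases hi : i ∈ Finset.Icc a b
          · exact h i hi
          · rw [Finset.mem_Icc, not_and_or, not_le, not_le] at hi
            exact hi.elim (fun hi => K.isZero_of_isStrictlyGE a i hi)
              (fun hi => K.isZero_of_isStrictlyLE b i hi)
        refine ObjectProperty.prop_of_isZero J (isZero_of_vanishesAt fun n => ?_)
        exact (vanishesAt_iff n (Iso.refl _)).2
          (acyclic_of_isZero fun i => (ev R n).map_isZero (hz i))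
  obtain ⟨K, hK, ⟨e⟩⟩ := exists_bounded_representative V
  obtain ⟨a, b, ha, hb⟩ := id hK
  refine J.prop_of_iso (Functor.preimageIso DerivedCategory.Bounded.ι ?_)
    (key a b _ K hK ha hb rfl)
  exact e.symm

end Devissage

section Classification

variable [IsTensorRelations R] (hQ : NoCycles Q)

lemma isPrimeIdeal_vanishesAt (hQ : NoCycles Q) (n : Paths Q) :
    IsPrimeIdeal (tensorObj (A := RelRep R)) (vanishesAt n) where
  triangulated := inferInstance
  isoClosed := inferInstance
  thick := inferInstance
  tensor_mem _ W h := vanishesAt_tensorObj_left n h W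
  ne_top h := not_vanishesAt_simpleObj n hQ 0 (h ▸ trivial : vanishesAt n (simpleObj R hQ n 0))
  mem_or_mem _ _ h := vanishesAt_or_of_tensorObj n h

/-- Tensoring with the simple object at `n` removes all cohomology away from `n` and, at `n`,
preserves whether there is any. -/
lemma eq_vanishesAt_of_simpleObj_notMem {P : ObjectProperty (D R)}
    (hP : IsPrimeIdeal (tensorObj (A := RelRep R)) P) {n : Paths Q}
    (hn : ¬ P (simpleObj R hQ n 0)) : P = vanishesAt n := by
  have := hP.triangulated
  have := hP.isoClosed
  have := hP.thick
  have hm (V : D R) (m : Paths Q) (hm : m ≠ n) :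
      vanishesAt m (tensorObj V (simpleObj R hQ n 0)) :=
    vanishesAt_tensorObj_right m V (vanishesAt_simpleObj n hQ hm 0)
  ext V
  refine ⟨fun hV => by_contra fun hcon => ?_, fun hV => ?_⟩
  · have hX : ¬ vanishesAt n (tensorObj V (simpleObj R hQ n 0)) := fun h =>
      (vanishesAt_or_of_tensorObj n h).elim hcon (not_vanishesAt_simpleObj n hQ 0)
    obtain ⟨i, ⟨r⟩⟩ := retract_of_not_vanishesAt hQ (hm V) hX
    exact hn (simpleObj_mem n hQ P 0 (P.prop_of_retract r (hP.tensor_mem _ _ hV)))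
  · refine (hP.mem_or_mem V _ (ObjectProperty.prop_of_isZero P
      (isZero_of_vanishesAt fun m => ?_))).resolve_right hn
    by_cases h : m = n
    · subst h
      exact vanishesAt_tensorObj_left m hV _
    · exact hm V m h

/-- The prime ideal of the objects whose cohomology vanishes at the vertex `n`. -/
def primeAt (n : Paths Q) : SpcD R := ⟨vanishesAt n, isPrimeIdeal_vanishesAt hQ n⟩

lemma primeAt_injective : Function.Injective (primeAt (R := R) hQ) := fun m n h => by
  by_contra hne
  have h' : vanishesAt (R := R) m = vanishesAt n := congrArg Subtype.val h
  exact not_vanishesAt_simpleObj (R := R) n hQ 0 (h' ▸ vanishesAt_simpleObj n hQ hne 0)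

lemma primeAt_surjective [Finite Q] : Function.Surjective (primeAt (R := R) hQ) := fun P => by
  have := P.2.triangulated
  have := P.2.isoClosed
  obtain ⟨n, hn⟩ : ∃ n, ¬ P.1 (simpleObj R hQ n 0) := by
    by_contra! h
    exact P.2.ne_top (by
      ext V
      exact iff_of_true (forall_mem_of_simpleObj_mem hQ P.1 h V) trivial)
  exact ⟨n, Subtype.ext (eq_vanishesAt_of_simpleObj_notMem hQ P.2 hn).symm⟩

/-- The bijection between the vertices and the prime ideals. -/
def primeEquiv [Finite Q] : Paths Q ≃ SpcD R :=
  Equiv.ofBijective (primeAt hQ) ⟨primeAt_injective hQ, primeAt_surjective hQ⟩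

lemma discreteTopology_spc (hQ : NoCycles Q) [Finite Q] : DiscreteTopology (SpcD R) := by
  have : Finite (Paths Q) := ‹Finite Q›
  have : Finite (SpcD R) := Finite.of_equiv _ (primeEquiv hQ)
  have : T1Space (SpcD R) := ⟨fun P => by
    obtain ⟨n, rfl⟩ := primeAt_surjective hQ P
    -- The simple object at `n` lies in every prime except the one at `n`, so its zero locus is that
    -- single point.
    refine isOpen_compl_iff.1 ⟨{simpleObj R hQ n 0}, ?_⟩
    rw [compl_compl]
    ext P
    obtain ⟨m, rfl⟩ := primeAt_surjective hQ P
    simp only [zeroLocus, Set.mem_singleton_iff, forall_eq, (primeAt_injective hQ).eq_iff]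
    refine ⟨fun h => by_contra fun hne => h (vanishesAt_simpleObj n hQ hne 0), ?_⟩
    rintro rfl
    exact not_vanishesAt_simpleObj m hQ 0⟩
  infer_instance

end Classification

end Primes

/-! ### Exact endofunctors on the bounded derived category -/

section ExactFunctors

variable {A : Type u} [Category.{v} A] [Abelian A] [HasDerivedCategory.{w} A]
  (F G : A ⥤ A) [F.Additive] [PreservesFiniteLimits F] [PreservesFiniteColimits F]
  [G.Additive] [PreservesFiniteLimits G] [PreservesFiniteColimits G]

lemma bounded_mapDerivedCategory_obj (X : DerivedCategory.Bounded A) :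
    (DerivedCategory.TStructure.t (C := A)).bounded (F.mapDerivedCategory.obj X.obj) := by
  obtain ⟨K, hK, ⟨e⟩⟩ := exists_bounded_representative X
  exact ObjectProperty.prop_of_iso _ (F.mapDerivedCategory.mapIso e ≪≫
    F.mapDerivedCategoryFactors.app K).symm (bounded_Q_obj (isBounded_mapComplex F hK))

/-- The endofunctor of `D^b(A)` induced by an exact endofunctor of `A`. -/
def mapBounded : DerivedCategory.Bounded A ⥤ DerivedCategory.Bounded A :=
  ObjectProperty.lift _ (DerivedCategory.Bounded.ι ⋙ F.mapDerivedCategory)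
    (bounded_mapDerivedCategory_obj F)

variable {F G}

/-- The natural transformation of functors between derived categories induced by a natural
transformation of exact functors. -/
def mapDerivedTrans (τ : F ⟶ G) : F.mapDerivedCategory ⟶ G.mapDerivedCategory :=
  Localization.liftNatTrans DerivedCategory.Q
    (HomologicalComplex.quasiIso A (ComplexShape.up ℤ)) (F.mapHomologicalComplex _ ⋙
      DerivedCategory.Q) (G.mapHomologicalComplex _ ⋙ DerivedCategory.Q) _ _
    (Functor.whiskerRight (NatTrans.mapHomologicalComplex τ _) DerivedCategory.Q)

lemma mapDerivedTrans_app (τ : F ⟶ G) (K : CochainComplex A ℤ) :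
    (mapDerivedTrans τ).app (DerivedCategory.Q.obj K) =
      F.mapDerivedCategoryFactors.hom.app K ≫
        DerivedCategory.Q.map ((NatTrans.mapHomologicalComplex τ _).app K) ≫
          G.mapDerivedCategoryFactors.inv.app K :=
  Localization.liftNatTrans_app _ _ _ _ _ _ _ _

/-- The natural transformation of endofunctors of `D^b(A)` induced by a natural transformation of
exact functors. -/
def mapBoundedTrans (τ : F ⟶ G) : mapBounded F ⟶ mapBounded G where
  app X := ObjectProperty.homMk ((mapDerivedTrans τ).app X.obj)
  naturality X Y f := by
    ext
    exact (mapDerivedTrans τ).naturality f.hom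

variable (A) in
/-- The identity functor of `A` induces the identity functor of the derived category. -/
def mapDerivedCategoryId : (𝟭 A).mapDerivedCategory ≅ 𝟭 _ :=
  Localization.liftNatIso DerivedCategory.Q
    (HomologicalComplex.quasiIso A (ComplexShape.up ℤ)) ((𝟭 A).mapHomologicalComplex _ ⋙
      DerivedCategory.Q) DerivedCategory.Q _ _
    (Functor.isoWhiskerRight (Functor.mapHomologicalComplexIdIso A _) DerivedCategory.Q ≪≫
      Functor.leftUnitor _)

variable (A) in
/-- The identity functor of `A` induces the identity functor of `D^b(A)`. -/
def mapBoundedId : mapBounded (𝟭 A) ≅ 𝟭 _ :=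
  NatIso.ofComponents (fun X => ObjectProperty.isoMk _ ((mapDerivedCategoryId A).app X.obj))
    fun f => by
      ext
      exact (mapDerivedCategoryId A).hom.naturality f.hom

end ExactFunctors

/-! ### Morphisms in the Verdier quotient at a vertex -/

section Quotient

variable {k : Type u} [Field k] {Q : Type v} [Quiver.{w} Q] {R : Relations k Q} (n : Paths Q)

/-- The cohomology of degree `i` at the vertex `n`. -/
abbrev derivedHomologyAt (R : Relations k Q) (n : Paths Q) (i : ℤ) :
    DerivedCategory (RelRep R) ⥤ FGModuleCat k :=
  DerivedCategory.homologyFunctor (RelRep R) i ⋙ ev R n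

/-- This is the long exact sequence of the homological functor: the cone has no cohomology at `n`
exactly if `f` is bijective on it. -/
lemma trW_vanishesAt_iff {V W : D R} (f : V ⟶ W) :
    (vanishesAt n).trW f ↔ ∀ i : ℤ, IsIso ((derivedHomologyAt R n i).map f.hom) := by
  let : (homologyAt (R := R) n).ShiftSequence ℤ := Functor.ShiftSequence.tautological _ _
  rw [vanishesAt_eq_homologicalKernel, Functor.mem_homologicalKernel_trW_iff]
  refine forall_congr' fun i => NatIso.isIso_map_iff (F₂ := DerivedCategory.Bounded.ι ⋙
    derivedHomologyAt R n i) ?_ f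
  exact Functor.isoWhiskerRight (Functor.isoWhiskerRight
    (DerivedCategory.Bounded.ι.commShiftIso i) (DerivedCategory.homologyFunctor (RelRep R) 0) ≪≫
    Functor.isoWhiskerLeft DerivedCategory.Bounded.ι
      ((DerivedCategory.homologyFunctor (RelRep R) 0).isoShift i)) (ev R n)

variable {n}

lemma isIso_derivedHomologyAt_Q_map {K L : CochainComplex (RelRep R) ℤ} (f : K ⟶ L)
    (h : ∀ i, IsIso ((ev R n).map (f.f i))) (i : ℤ) :
    IsIso ((derivedHomologyAt R n i).map (DerivedCategory.Q.map f)) := by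
  refine (NatIso.isIso_map_iff (F₁ := HomologicalComplex.shortComplexFunctor (RelRep R)
      (ComplexShape.up ℤ) i ⋙ (ev R n).mapShortComplex ⋙ ShortComplex.homologyFunctor _)
    (F₂ := DerivedCategory.Q ⋙ derivedHomologyAt R n i) ?_ f).1 ?_
  · exact Functor.isoWhiskerLeft _ (ShortComplex.homologyFunctorIso (ev R n)) ≪≫
      Functor.isoWhiskerRight ((HomologicalComplex.homologyFunctorIso _ _ i).symm ≪≫
        (DerivedCategory.homologyFunctorFactors (RelRep R) i).symm) (ev R n)
  · set φ := (ev R n).mapShortComplex.map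
      ((HomologicalComplex.shortComplexFunctor (RelRep R) (ComplexShape.up ℤ) i).map f)
    have : IsIso φ.τ₁ := h _
    have : IsIso φ.τ₂ := h _
    have : IsIso φ.τ₃ := h _
    have : IsIso φ := ShortComplex.isIso_of_isIso φ
    exact Functor.map_isIso (ShortComplex.homologyFunctor _) φ

variable {F G : RelRep R ⥤ RelRep R} [F.Additive] [PreservesFiniteLimits F]
  [PreservesFiniteColimits F] [G.Additive] [PreservesFiniteLimits G] [PreservesFiniteColimits G]

lemma isIso_derivedHomologyAt_trans (τ : F ⟶ G) (h : ∀ V, IsIso ((ev R n).map (τ.app V)))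
    (X : DerivedCategory (RelRep R)) (i : ℤ) :
    IsIso ((derivedHomologyAt R n i).map ((mapDerivedTrans τ).app X)) := by
  have e := DerivedCategory.Q.objObjPreimageIso X
  have h₁ : (mapDerivedTrans τ).app X = F.mapDerivedCategory.map e.inv ≫
      (mapDerivedTrans τ).app _ ≫ G.mapDerivedCategory.map e.hom := by
    rw [← NatTrans.naturality, ← Functor.map_comp_assoc, e.inv_hom_id,
      CategoryTheory.Functor.map_id, Category.id_comp]
  have := isIso_derivedHomologyAt_Q_map (n := n) ((NatTrans.mapHomologicalComplex τ _).app
    (DerivedCategory.Q.objPreimage X)) (fun j => h _) i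
  rw [h₁, mapDerivedTrans_app]
  simp only [Functor.map_comp (derivedHomologyAt R n i)]
  infer_instance

lemma trW_mapBoundedTrans (τ : F ⟶ G) (h : ∀ V, IsIso ((ev R n).map (τ.app V))) (X : D R) :
    (vanishesAt n).trW ((mapBoundedTrans τ).app X) :=
  (trW_vanishesAt_iff n _).2 fun i => isIso_derivedHomologyAt_trans τ h X.obj i

lemma trW_mapBounded_iff (τ : F ⟶ G) (h : ∀ V, IsIso ((ev R n).map (τ.app V))) {X Y : D R}
    (f : X ⟶ Y) : (vanishesAt n).trW ((mapBounded F).map f) ↔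
      (vanishesAt n).trW ((mapBounded G).map f) := by
  rw [trW_vanishesAt_iff, trW_vanishesAt_iff]
  refine forall_congr' fun i => ?_
  let e : F.mapDerivedCategory ⋙ derivedHomologyAt R n i ≅
      G.mapDerivedCategory ⋙ derivedHomologyAt R n i :=
    have (X : DerivedCategory (RelRep R)) : IsIso ((Functor.whiskerRight (mapDerivedTrans τ)
      (derivedHomologyAt R n i)).app X) := isIso_derivedHomologyAt_trans τ h X i
    have : IsIso (Functor.whiskerRight (mapDerivedTrans τ) (derivedHomologyAt R n i)) :=
      NatIso.isIso_of_isIso_app _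
    asIso (Functor.whiskerRight (mapDerivedTrans τ) (derivedHomologyAt R n i))
  exact NatIso.isIso_map_iff e f.hom

/-- In the quotient, `τ` becomes a natural isomorphism. The ideal `P` is kept as a variable because
the subcategory defining the presheaf is only propositionally equal to `vanishesAt n`. -/
lemma map_mapBounded_eq_iff {P : ObjectProperty (D R)} (hP : P = vanishesAt n) (τ : F ⟶ G)
    (h : ∀ V, IsIso ((ev R n).map (τ.app V))) {X Y : D R} (f g : X ⟶ Y) :
    P.trW.Q.map ((mapBounded F).map f) = P.trW.Q.map ((mapBounded F).map g) ↔
      P.trW.Q.map ((mapBounded G).map f) = P.trW.Q.map ((mapBounded G).map g) := by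
  subst hP
  have (X : D R) : IsIso ((vanishesAt n).trW.Q.map ((mapBoundedTrans τ).app X)) :=
    (vanishesAt n).trW.Q_inverts _ (trW_mapBoundedTrans τ h X)
  let e : mapBounded F ⋙ (vanishesAt n).trW.Q ≅ mapBounded G ⋙ (vanishesAt n).trW.Q :=
    NatIso.ofComponents (fun X => asIso ((vanishesAt n).trW.Q.map ((mapBoundedTrans τ).app X)))
      fun f => by simp [← Functor.map_comp]
  have he (f : X ⟶ Y) : e.hom.app X ≫ (vanishesAt n).trW.Q.map ((mapBounded G).map f) =
    (vanishesAt n).trW.Q.map ((mapBounded F).map f) ≫ e.hom.app Y := (e.hom.naturality f).symm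
  rw [← cancel_mono (e.hom.app Y), ← he, ← he, cancel_epi]

end Quotient

/-! ### Endomorphisms of the unit in the quotient at a vertex -/

section EndUnit

variable {k : Type u} [Field k] {Q : Type v} [Quiver.{w} Q] {R : Relations k Q}

instance (C : Set (Paths Q)) (hC : IsConvex C) : (res R C hC).Linear k where
  map_smul f c := by
    ext x : 3
    exact condMap_smul c (f.hom.app x)

variable (hQ : NoCycles Q) {n : Paths Q}

section

variable {P : ObjectProperty (D R)}

/-- Follow the roof `𝟭 ← resReach R n → resAt hQ R n`, whose two arrows are isomorphisms at `n`. -/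
lemma map_mapBounded_resAt_eq_iff (hP : P = vanishesAt n) {X Y : D R} (f g : X ⟶ Y) :
    P.trW.Q.map ((mapBounded (resAt hQ R n)).map f) =
      P.trW.Q.map ((mapBounded (resAt hQ R n)).map g) ↔ P.trW.Q.map f = P.trW.Q.map g := by
  rw [← map_mapBounded_eq_iff hP (resReachπ hQ R n) (isIso_ev_resReachπ hQ R n),
    map_mapBounded_eq_iff hP (resReachι R n) (isIso_ev_resReachι R n (self_mem_reachable n))]
  let e := Functor.isoWhiskerRight (mapBoundedId (RelRep R)) P.trW.Q
  have he (f : X ⟶ Y) : P.trW.Q.map ((mapBounded (𝟭 (RelRep R))).map f) =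
    e.hom.app X ≫ P.trW.Q.map f ≫ e.inv.app Y := (NatIso.naturality_2 e f).symm
  rw [he, he, cancel_epi, cancel_mono]

end

lemma trW_mapBounded_resAt_iff {X Y : D R} (f : X ⟶ Y) :
    (vanishesAt n).trW ((mapBounded (resAt hQ R n)).map f) ↔ (vanishesAt n).trW f := by
  rw [← trW_mapBounded_iff (resReachπ hQ R n) (isIso_ev_resReachπ hQ R n),
    trW_mapBounded_iff (resReachι R n) (isIso_ev_resReachι R n (self_mem_reachable n))]
  exact (vanishesAt n).trW.arrow_mk_iso_iff
    (((Functor.mapArrowFunctor _ _).mapIso (mapBoundedId (RelRep R))).app (Arrow.mk f))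

lemma vanishesAt_mapBounded_resAt {m : Paths Q} (hm : m ≠ n) (X : D R) :
    vanishesAt m ((mapBounded (resAt hQ R n)).obj X) := by
  obtain ⟨K, hK, ⟨e⟩⟩ := exists_bounded_representative X
  refine (vanishesAt_iff m ((resAt hQ R n).mapDerivedCategory.mapIso e ≪≫
    (resAt hQ R n).mapDerivedCategoryFactors.app K)).2
    (acyclic_of_isZero fun i => isZero_ev_resAt hQ R hm (K.X i))

/-- After restriction nothing is left away from `n`, so being an isomorphism on cohomology at `n`
suffices. -/
lemma isIso_mapBounded_resAt_map {X Y : D R} {f : X ⟶ Y} (hf : (vanishesAt n).trW f) :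
    IsIso ((mapBounded (resAt hQ R n)).map f) := by
  have : IsIso (DerivedCategory.Bounded.ι.map ((mapBounded (resAt hQ R n)).map f)) := by
    rw [DerivedCategory.isIso_iff]
    refine fun i => isIso_of_ev _ fun m => ?_
    by_cases hm : m = n
    · subst hm
      exact (trW_vanishesAt_iff m _).1 ((trW_mapBounded_resAt_iff hQ f).2 hf) i
    · exact (vanishesAt_mapBounded_resAt hQ hm X i).isIso
        (vanishesAt_mapBounded_resAt hQ hm Y i) _
  exact isIso_of_fully_faithful DerivedCategory.Bounded.ι _

lemma mapBounded_resAt_map_smul {X Y : D R} (c : k) (f : X ⟶ Y) :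
    (mapBounded (resAt hQ R n)).map (c • f) = c • (mapBounded (resAt hQ R n)).map f := by
  ext
  exact Functor.map_smul (resAt hQ R n).mapDerivedCategory c f.hom

lemma end_eq_smul_of_iso {C : Type*} [Category* C] [Preadditive C] [Linear k C] {X Y : C}
    (e : X ≅ Y) (h : ∀ g : Y ⟶ Y, ∃ c : k, g = c • 𝟙 Y) (f : X ⟶ X) : ∃ c : k, f = c • 𝟙 X := by
  obtain ⟨c, hc⟩ := h (e.inv ≫ f ≫ e.hom)
  refine ⟨c, ?_⟩
  rw [Iso.inv_comp_eq, ← Iso.eq_comp_inv] at hc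
  simpa using hc

variable [IsTensorRelations R]

lemma not_vanishesAt_unitObj (n : Paths Q) : ¬ vanishesAt n (unitObj (RelRep R)) := fun h => by
  have h := (h 0).of_iso ((ev R n).mapIso
    ((DerivedCategory.singleFunctorCompHomologyFunctorIso (RelRep R) 0).app (𝟙_ _)).symm)
  have := (isZero_iff_subsingleton _).1 h
  exact one_ne_zero (α := k) (this.elim (α := k) _ _)

/-- The image of the unit is the simple representation in degree zero, and representations embed
fully into the derived category. -/
lemma mapBounded_unitObj_end_eq_smul
    (f : (mapBounded (resAt hQ R n)).obj (unitObj (RelRep R)) ⟶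
      (mapBounded (resAt hQ R n)).obj (unitObj (RelRep R))) : ∃ c : k, f = c • 𝟙 _ := by
  let S := DerivedCategory.singleFunctor (RelRep R) 0
  let e : (resAt hQ R n).mapDerivedCategory.obj (unitObj (RelRep R)).obj ≅
      S.obj (simple hQ R n) :=
    (resAt hQ R n).mapDerivedCategory.mapIso
      ((DerivedCategory.singleFunctorIsoCompQ (RelRep R) 0).symm.app (𝟙_ (RelRep R))) ≪≫
      ((resAt hQ R n).mapDerivedCategorySingleFunctor 0).app (𝟙_ (RelRep R))
  obtain ⟨c, hc⟩ := end_eq_smul_of_iso e (fun g => by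
    obtain ⟨g, rfl⟩ := S.map_surjective g
    obtain ⟨c, rfl⟩ := simple_end_eq_smul hQ g
    exact ⟨c, (S.map_smul c _).trans (congrArg (c • ·) (S.map_id _))⟩) f.hom
  refine ⟨c, ?_⟩
  ext
  exact hc

/-- The endomorphisms of the unit object in the quotient by the prime ideal at `n` are scalars. -/
lemma algebraMap_end_bijective (hQ : NoCycles Q) {P : ObjectProperty (D R)} [P.IsTriangulated]
    (hP : P = vanishesAt n) :
    Function.Bijective (algebraMap k (End (P.trW.Q.obj (unitObj (RelRep R))))) := by
  have hid : (𝟙 _ : End (P.trW.Q.obj (unitObj (RelRep R)))) ≠ 0 := fun h => by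
    have h₀ : P.trW.Q.map (𝟙 (unitObj (RelRep R))) = P.trW.Q.map 0 :=
      (CategoryTheory.Functor.map_id _ _).trans (h.trans (P.trW.Q.map_zero _ _).symm)
    -- If the identity were zero in the quotient, some `s` to the unit with cone in `P` would be
    -- zero. It would be both zero and bijective on the cohomology of the unit at `n`.
    rw [MorphismProperty.map_eq_iff_precomp P.trW.Q P.trW] at h₀
    obtain ⟨X, s, hs, h₀⟩ := h₀
    rw [Category.comp_id, comp_zero] at h₀
    refine not_vanishesAt_unitObj (R := R) n fun i => ?_
    have := (trW_vanishesAt_iff n _).1 (hP ▸ hs) i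
    exact IsZero.of_epi_eq_zero ((derivedHomologyAt R n i).map s.hom)
      ((congrArg (fun s => (derivedHomologyAt R n i).map s.hom) h₀).trans
        ((derivedHomologyAt R n i).map_zero _ _))
  have : Nontrivial (End (P.trW.Q.obj (unitObj (RelRep R)))) := ⟨_, _, hid⟩
  refine ⟨(algebraMap k _).injective, fun f => ?_⟩
  obtain ⟨φ, hφ⟩ := Localization.exists_rightFraction P.trW.Q P.trW f
  have hf : P.trW.Q.map φ.s ≫ f = P.trW.Q.map φ.f := by
    rw [hφ, MorphismProperty.RightFraction.map_s_comp_map]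
  have hs := φ.hs
  have := isIso_mapBounded_resAt_map (n := n) hQ (f := φ.s) (by rwa [← hP])
  have := P.trW.Q_inverts _ hs
  -- For the fraction `f = φ.f ∘ φ.s⁻¹`, the image of `φ.s` is already invertible before passing to
  -- the quotient, so the restricted fraction is a genuine endomorphism and yields the scalar.
  obtain ⟨c, hc⟩ := mapBounded_unitObj_end_eq_smul hQ
    (inv ((mapBounded (resAt hQ R n)).map φ.s) ≫ (mapBounded (resAt hQ R n)).map φ.f)
  refine ⟨c, ?_⟩
  rw [Algebra.algebraMap_eq_smul_one, ← cancel_epi (P.trW.Q.map φ.s), hf]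
  have h₁ : P.trW.Q.map φ.f = P.trW.Q.map (c • φ.s) := by
    rw [← map_mapBounded_resAt_eq_iff hQ hP, mapBounded_resAt_map_smul]
    rw [IsIso.inv_comp_eq] at hc
    rw [hc]
    simp
  rw [h₁, Functor.map_smul]
  refine (Linear.comp_smul _ _ _ _ _ _).trans ?_
  exact congrArg (c • ·) (Category.comp_id _)

end EndUnit

/-! ### Sheaves of algebras on a discrete space -/

section DiscreteSheaves

variable (k : Type u) [Field k]

/-- On a discrete space, a morphism of presheaves of algebras which is bijective at all points
becomes an isomorphism after sheafification. -/
lemma W_of_bijective_singleton {X : TopCat.{w}} [DiscreteTopology X]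
    {F G : (Opens X)ᵒᵖ ⥤ AlgCat.{w} k} (φ : F ⟶ G)
    (h : ∀ (W : Opens X) (x : X), (W : Set X) = {x} →
      Function.Bijective (φ.app (op W)).hom) :
    (Opens.grothendieckTopology X).W φ := by
  rw [GrothendieckTopology.W_iff_isLocallyBijective]
  have key (U : Opens X) (x : X) (hx : x ∈ U) : ∃ (V : Opens X) (_ : V ⟶ U),
      x ∈ V ∧ Function.Bijective (φ.app (op V)).hom :=
    ⟨⟨{x}, isOpen_discrete _⟩, homOfLE (Set.singleton_subset_iff.2 hx), rfl, h _ x rfl⟩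
  refine ⟨⟨fun {U} a b hab x hx => ?_⟩, ⟨fun {U} a x hx => ?_⟩⟩
  · obtain ⟨V, i, hV, hb⟩ := key U.unop x hx
    refine ⟨V, i, hb.1 ?_, hV⟩
    have := congrArg (G.map i.op) hab
    rw [NatTrans.naturality_apply, NatTrans.naturality_apply]
    exact this
  · obtain ⟨V, i, hV, hb⟩ := key U x hx
    exact ⟨V, i, hb.2 _, hV⟩

variable (X : TopCat.{max u w})

/-- The presheaf of functions with values in `k`. -/
def functionPresheaf : (Opens X)ᵒᵖ ⥤ AlgCat.{max u w} k where
  obj W := AlgCat.of k (W.unop → ULift.{max u w} k)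
  map i := AlgCat.ofHom
    { toFun f x := f ⟨x.1, i.unop.le x.2⟩
      map_one' := rfl
      map_mul' _ _ := rfl
      map_zero' := rfl
      map_add' _ _ := rfl
      commutes' _ := rfl }

lemma isSheaf_functionPresheaf :
    Presheaf.IsSheaf (Opens.grothendieckTopology X) (functionPresheaf k X) := by
  rw [Presheaf.isSheaf_iff_isSheaf_forget _ _ (forget (AlgCat.{max u w} k))]
  exact TopCat.Presheaf.toTypes_isSheaf X fun _ => ULift.{max u w} k

variable {X}

/-- The morphism from the constant presheaf `k` to a presheaf of algebras. -/
def constToPresheaf (F : (Opens X)ᵒᵖ ⥤ AlgCat.{max u w} k) :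
    (Functor.const _).obj (AlgCat.of k (ULift.{max u w} k)) ⟶ F where
  app W := AlgCat.ofHom ((Algebra.ofId k (F.obj W)).comp ULift.algEquiv.toAlgHom)
  naturality W W' i := by
    ext c
    exact ((F.map i).hom.commutes c.down).symm

lemma functionPresheaf_bijective (W : Opens X) (x : X) (hW : (W : Set X) = {x}) :
    Function.Bijective (algebraMap k ((functionPresheaf k X).obj (op W))) := by
  have hx : x ∈ W := hW.ge rfl
  refine ⟨fun a b hab => ULift.up_injective (congrFun hab ⟨x, hx⟩),
    fun f => ⟨(f ⟨x, hx⟩).down, funext fun y => ?_⟩⟩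
  obtain rfl : y = ⟨x, hx⟩ := Subtype.ext (hW ▸ y.2 : y.1 ∈ ({x} : Set X))
  rfl

variable [DiscreteTopology X]

lemma W_constToPresheaf {F : (Opens X)ᵒᵖ ⥤ AlgCat.{max u w} k}
    (h : ∀ (W : Opens X) (x : X), (W : Set X) = {x} →
      Function.Bijective (algebraMap k (F.obj (op W)))) :
    (Opens.grothendieckTopology X).W (constToPresheaf k F) :=
  W_of_bijective_singleton k _ fun W x hW => (h W x hW).comp ULift.down_bijective

variable [HasSheafify (Opens.grothendieckTopology X) (AlgCat.{max u w} k)]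

lemma isIso_sheafify_constToPresheaf {F : (Opens X)ᵒᵖ ⥤ AlgCat.{max u w} k}
    (h : ∀ (W : Opens X) (x : X), (W : Set X) = {x} →
      Function.Bijective (algebraMap k (F.obj (op W)))) :
    IsIso ((presheafToSheaf (Opens.grothendieckTopology X) _).map (constToPresheaf k F)) :=
  ((Opens.grothendieckTopology X).W_iff _).1 (W_constToPresheaf k h)

/-- On a discrete space, the sheafification of a presheaf of algebras whose value at every point
is `k` is the constant sheaf. -/
def sheafifyIsoConstant {F : (Opens X)ᵒᵖ ⥤ AlgCat.{max u w} k}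
    (h : ∀ (W : Opens X) (x : X), (W : Set X) = {x} →
      Function.Bijective (algebraMap k (F.obj (op W)))) :
    (presheafToSheaf (Opens.grothendieckTopology X) _).obj F ≅
      (constantSheaf (Opens.grothendieckTopology X) _).obj
        (AlgCat.of k (ULift.{max u w} k)) :=
  haveI := isIso_sheafify_constToPresheaf k h
  (asIso ((presheafToSheaf (Opens.grothendieckTopology X) _).map (constToPresheaf k F))).symm

/-- A constant sheaf on a discrete space is the sheaf of functions. -/
def constantSheafIso :
    (constantSheaf (Opens.grothendieckTopology X) _).obj (AlgCat.of k (ULift.{max u w} k)) ≅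
      ⟨functionPresheaf.{u, w} k X, isSheaf_functionPresheaf.{u, w} k X⟩ :=
  -- The presheaf of functions has value `k` at each point, and it is its own sheafification.
  (sheafifyIsoConstant.{u, w} k (functionPresheaf_bijective.{u, w} k)).symm ≪≫
    (sheafificationIso ⟨functionPresheaf.{u, w} k X, isSheaf_functionPresheaf.{u, w} k X⟩).symm

/-- The algebra of functions on `W`. -/
def functionPresheafEquiv {V : Type*} (W : Opens X) (e : V ≃ W) :
    (functionPresheaf k X).obj (op W) ≃ₐ[k] (V → k) :=
  (AlgEquiv.piCongrRight fun _ => ULift.algEquiv).trans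
    (AlgEquiv.piCongrLeft k (fun _ : V => k) e.symm)

end DiscreteSheaves

/-! ### The structure sheaf -/

section StructureSheaf

variable {k : Type u} [Field k] {Q : Type v} [Quiver.{w} Q] {R : Relations k Q}
  [IsTensorRelations R] (hQ : NoCycles Q)

lemma supportedOn_compl_singleton (n : Paths Q) :
    supportedOn (tensorObj (A := RelRep R)) {primeAt hQ n}ᶜ = vanishesAt n := by
  ext V
  rw [supportedOn_iff]
  simp only [Set.mem_compl_iff, not_not, Set.mem_singleton_iff, forall_eq]
  rfl

variable [Finite Q]

/-- For a one-point open set, the objects supported on the complement are those of the prime itself,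
so the section algebra is computed in the quotient at one vertex. -/
lemma endPresheaf_bijective (hQ : NoCycles Q) (W : Opens (TopCat.of (SpcD R))) (P : SpcD R)
    (hW : (W : Set (SpcD R)) = {P}) : Function.Bijective (algebraMap k
      ((endPresheaf (tensorObj (A := RelRep R)) (unitObj (RelRep R)) k).obj (op W))) := by
  obtain ⟨n, rfl⟩ := primeAt_surjective hQ P
  exact algebraMap_end_bijective hQ
    ((congrArg (fun Z => supportedOn tensorObj Zᶜ) hW).trans (supportedOn_compl_singleton hQ n))

/-- The structure sheaf is the constant sheaf. -/
def structureSheafIso : structureSheafD R ≅ constantSheafD R :=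
  haveI := discreteTopology_spc (R := R) hQ
  sheafifyIsoConstant.{u, max (u + 1) v w} k (endPresheaf_bijective hQ)

/-- The sections of the structure sheaf are the functions with values in `k`. -/
def structureSheafEquiv (W : Opens (TopCat.of (SpcD R))) {V : Type*} (e : V ≃ W) :
    (structureSheafD R).obj.obj (op W) ≃ₐ[k] (V → k) :=
  haveI := discreteTopology_spc (R := R) hQ
  ((((sheafToPresheaf _ _).mapIso (structureSheafIso hQ ≪≫ constantSheafIso.{u, max (u + 1) v w} k)).app
    (op W)).toAlgEquiv).trans (functionPresheafEquiv.{u, max (u + 1) v w} k W e)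

end StructureSheaf

end QuiverSheaf

end

theorem mainTheorem4 {k : Type u} [Field k] {Q : Type v} [Quiver.{w} Q]
    [Finite Q] [∀ a b : Q, Finite (a ⟶ b)]
    (hQ : ∀ (a : Q) (p : Quiver.Path a a), p.length = 0)
    (R : QuiverSheaf.Relations k Q) [QuiverSheaf.IsTensorRelations R] :
    ∃ (_ : DiscreteTopology (QuiverSheaf.SpcD R)) (e : Q ≃ QuiverSheaf.SpcD R),
      (∀ (n : Q) (V : QuiverSheaf.D R),
        (e n).1 V ↔ ∀ i : ℤ, Subsingleton (QuiverSheaf.cohomologyAt R V i n)) ∧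
      Nonempty (QuiverSheaf.structureSheafD R ≅ QuiverSheaf.constantSheafD R) ∧
      ∀ W : Set Q,
        Nonempty ((QuiverSheaf.structureSheafD R).obj.obj
          (op ⟨e '' W, isOpen_discrete (e '' W)⟩) ≃ₐ[k] (W → k)) := by
  have hd := QuiverSheaf.discreteTopology_spc (R := R) hQ
  let e : Q ≃ QuiverSheaf.SpcD R := QuiverSheaf.primeEquiv hQ
  refine ⟨hd, e, fun n V => forall_congr' fun i => QuiverSheaf.isZero_iff_subsingleton _,
    ⟨QuiverSheaf.structureSheafIso hQ⟩, fun W => ⟨?_⟩⟩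
  exact QuiverSheaf.structureSheafEquiv hQ _ (e.image W)
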